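/- Let $\hbar>0$, $n\ge 0$. An $N$-mode system has Hilbert space $L^2(\mathbb R^N)$ with $Q_j$ multiplication by $x_j$ and $P_j=-i\hbar\,\partial_j$. Phase space is ordered $Q_1,P_1,Q_2,P_2,\dots$, and $\Omega_N=\bigoplus_{j=1}^N\Omega_1$ with $\Omega_1=\begin{bmatrix}0&1\\-1&0\end{bmatrix}$. For $\vec v\in\mathbb R^{2N}$ let $D_{\vec v}=\exp\!\big(\tfrac{i}{\hbar}\sum_j(v_{2j}Q_j-v_{2j-1}P_j)\big)$ be the displacement operator that shifts phase space by $\vec v$. A density operator $\rho$ is Gaussian with mean $\mu\in\mathbb R^{2N}$ and (real symmetric) covariance matrix $\Sigma$ if $\operatorname{tr}(\rho D_{\vec v})=\exp\!\big(-\tfrac1{2\hbar^2}(\Omega_N\vec v)^{\mathrm T}\Sigma\,(\Omega_N\vec v)+\tfrac i\hbar(\Omega_N\vec v)^{\mathrm T}\mu\big)$ for all $\vec v$. The effective squeezing parameter of a one-mode state $\tilde\rho$ with respect to $D_{\vec v}$, $\vec v\in\mathbb R^2$, is $\sigma_{\vec v}^2(\tilde\rho)=\frac2\pi\log\frac1{|\operatorname{tr}(\tilde\rho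 D_{\vec v})|}\in[0,\infty]$. **Proposition.** Let $\rho$ be a $(1+n)$-mode Gaussian density operator with covariance matrix $\Sigma$, let $\vec v\in\mathbb R^2$, and for a sign $s\in\{+1,-1\}$ consider the semidefinite program $$\text{maximize}\quad \frac1{\pi\hbar^2}(\Omega_1\vec v)^{\mathrm T}Z\,(\Omega_1\vec v)\quad\text{subject to}\quad Z\in\mathrm{Herm}(\mathbb C^{2\times2}),\quad Z\ge i\tfrac\hbar2\Omega_1,\quad \Sigma+s\begin{bmatrix}0&0\\0&i\frac\hbar2\Omega_n\end{bmatrix}\ge\begin{bmatrix}Z&0\\0&0\end{bmatrix}.$$ For $s=-1$ the program is feasible and its maximum is attained. For either sign $s$, let $b_s$ be the supremum of the objective ($-\infty$ if the program is infeasible). Let $E$ be any operator on the Hilbert space of the last $n$ modes with $0\le E\le 1$ (a POVM element, possibly non-Gaussian) whose success probability $p=\operatorname{tr}(\rho(\mathbb 1\otimes E))$ is nonzero, and let $\tilde\rho=\frac1p\operatorname{tr}_{2,\dots,n+1}\big(\rho(\mathbb 1\otimes E)\big)$ be the post-selected state of the first mode. Then $$|\operatorname{tr}(\tilde\rho D_{\vec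 v})|\le\exp\!\Big(-\frac1{2\hbar^2}(\Omega_1\vec v)^{\mathrm T}Z\,(\Omega_1\vec v)\Big)\quad\text{for every feasible }Z,$$ and hence $b_s\le\sigma^2_{\vec v}(\tilde\rho)$. -/

import Mathlib

noncomputable section

namespace CVQuantum

open MeasureTheory Complex
open scoped Matrix ComplexOrder ENNReal

/-! ## Bosonic modes in the Schroedinger representation -/

/-- The Hilbert space `L²(ℝ^ι)` of a system whose modes are labelled by `ι`. -/
abbrev ModeSpace (ι : Type) [Fintype ι] : Type :=
  Lp ℂ 2 (volume : Measure (ι → ℝ))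

variable {ι κ : Type} [Fintype ι] [Fintype κ]

/-- The unimodular factor `exp((i/ħ) ∑ⱼ (bⱼ xⱼ - aⱼ bⱼ / 2))`, where `v` has position part `a`
(components `(j, 0)`) and momentum part `b` (components `(j, 1)`). -/
def displacementPhase (ħ : ℝ) (v : ι × Fin 2 → ℝ) (x : ι → ℝ) : ℂ :=
  Complex.exp (((ħ⁻¹ * ∑ j, (v (j, 1) * x j - v (j, 0) * v (j, 1) / 2) : ℝ) : ℂ) * I)

theorem norm_displacementPhase (ħ : ℝ) (v : ι × Fin 2 → ℝ) (x : ι → ℝ) :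
    ‖displacementPhase ħ v x‖ = 1 :=
  Complex.norm_exp_ofReal_mul_I _

theorem continuous_displacementPhase (ħ : ℝ) (v : ι × Fin 2 → ℝ) :
    Continuous (displacementPhase ħ v) := by
  unfold displacementPhase
  fun_prop

theorem displacement_measurePreserving (v : ι × Fin 2 → ℝ) :
    MeasurePreserving (fun x : ι → ℝ => x - fun j => v (j, 0)) volume volume :=
  measurePreserving_sub_right volume _

/-- The function `x ↦ exp((i/ħ) (b·x - a·b/2)) ψ(x - a)`. -/
def displacementFun (ħ : ℝ) (v : ι × Fin 2 → ℝ) (ψ : (ι → ℝ) → ℂ) (x : ι → ℝ) : ℂ :=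
  displacementPhase ħ v x * ψ (x - fun j => v (j, 0))

theorem memLp_displacementFun (ħ : ℝ) (v : ι × Fin 2 → ℝ) (ψ : ModeSpace ι) :
    MemLp (displacementFun ħ v ψ) 2 volume := by
  have h1 : MemLp (fun x : ι → ℝ => ψ (x - fun j => v (j, 0))) 2 volume :=
    (Lp.memLp ψ).comp_measurePreserving (displacement_measurePreserving v)
  refine h1.congr_norm
    ((continuous_displacementPhase ħ v).aestronglyMeasurable.mul h1.aestronglyMeasurable) ?_
  filter_upwards with x
  simp [displacementFun, norm_displacementPhase]

/-- The displacement operator `D_v = exp((i/ħ) ∑ⱼ (bⱼ Qⱼ - aⱼ Pⱼ))`, `v = (a₁, b₁, a₂, b₂, …)`,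
on `L²(ℝ^ι)`, with `(Qⱼ ψ)(x) = xⱼ ψ(x)` and `Pⱼ = -iħ ∂ⱼ`; explicitly
`(D_v ψ)(x) = exp((i/ħ) (b·x - a·b/2)) ψ(x - a)`. It shifts phase space by `v`. -/
def displacement (ħ : ℝ) (v : ι × Fin 2 → ℝ) : ModeSpace ι →L[ℂ] ModeSpace ι :=
  LinearMap.mkContinuous
    { toFun := fun ψ => (memLp_displacementFun ħ v ψ).toLp (displacementFun ħ v ψ)
      map_add' := by
        intro ψ φ
        rw [← MemLp.toLp_add]
        apply MemLp.toLp_congr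
        have h := (displacement_measurePreserving v).quasiMeasurePreserving.ae
          (Lp.coeFn_add ψ φ)
        filter_upwards [h] with x hx
        simp only [displacementFun, Pi.add_apply] at hx ⊢
        rw [hx, mul_add]
      map_smul' := by
        intro c ψ
        rw [RingHom.id_apply, ← MemLp.toLp_const_smul]
        apply MemLp.toLp_congr
        have h := (displacement_measurePreserving v).quasiMeasurePreserving.ae
          (Lp.coeFn_smul c ψ)
        filter_upwards [h] with x hx
        simp only [displacementFun, Pi.smul_apply, smul_eq_mul] at hx ⊢
        rw [hx]
        ring }
    1
    (by
      intro ψ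
      rw [one_mul]
      simp only [LinearMap.coe_mk, AddHom.coe_mk]
      rw [Lp.norm_toLp, Lp.norm_def]
      apply ENNReal.toReal_mono (Lp.eLpNorm_ne_top ψ)
      have h : eLpNorm (displacementFun ħ v ψ) 2 volume
          = eLpNorm (fun x : ι → ℝ => ψ (x - fun j => v (j, 0))) 2 volume := by
        apply eLpNorm_congr_norm_ae
        filter_upwards with x
        simp [displacementFun, norm_displacementPhase]
      rw [h]
      exact (eLpNorm_comp_measurePreserving (Lp.aestronglyMeasurable ψ)
        (displacement_measurePreserving v)).le)

theorem displacement_coeFn (ħ : ℝ) (v : ι × Fin 2 → ℝ) (ψ : ModeSpace ι) :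
    displacement ħ v ψ =ᵐ[volume] displacementFun ħ v ψ :=
  MemLp.coeFn_toLp (memLp_displacementFun ħ v ψ)

/-- The function `(x, y) ↦ f(x) g(y)` of the configurations of a bipartite system. -/
def prodFun (f : (ι → ℝ) → ℂ) (g : (κ → ℝ) → ℂ) (z : ι ⊕ κ → ℝ) : ℂ :=
  f (fun i => z (Sum.inl i)) * g (fun k => z (Sum.inr k))

theorem memLp_prodFun (f : ModeSpace ι) (g : ModeSpace κ) :
    MemLp (prodFun f g) 2 (volume : Measure (ι ⊕ κ → ℝ)) := by
  have hp : MemLp (fun q : (ι → ℝ) × (κ → ℝ) => f q.1 * g q.2) 2 (volume.prod volume) := by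
    have hm : AEStronglyMeasurable (fun q : (ι → ℝ) × (κ → ℝ) => f q.1 * g q.2)
        ((volume : Measure (ι → ℝ)).prod (volume : Measure (κ → ℝ))) :=
      (Lp.aestronglyMeasurable f).comp_fst.mul (Lp.aestronglyMeasurable g).comp_snd
    rw [memLp_two_iff_integrable_sq_norm hm]
    have h := ((memLp_two_iff_integrable_sq_norm (Lp.aestronglyMeasurable f)).1
      (Lp.memLp f)).mul_prod ((memLp_two_iff_integrable_sq_norm (Lp.aestronglyMeasurable g)).1
      (Lp.memLp g))
    refine h.congr ?_
    filter_upwards with q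
    simp [mul_pow]
  exact hp.comp_measurePreserving
    (volume_measurePreserving_sumPiEquivProdPi (fun _ : ι ⊕ κ => ℝ))

/-- The product vector `f ⊗ g` in `L²(ℝ^ι × ℝ^κ) = L²(ℝ^ι) ⊗ L²(ℝ^κ)`. -/
def prodVec (f : ModeSpace ι) (g : ModeSpace κ) : ModeSpace (ι ⊕ κ) :=
  (memLp_prodFun f g).toLp (prodFun f g)

theorem prodVec_coeFn (f : ModeSpace ι) (g : ModeSpace κ) :
    prodVec f g =ᵐ[volume] prodFun f g :=
  MemLp.coeFn_toLp (memLp_prodFun f g)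

/-! ## States and post-selection -/

/-- `T` has a trace, equal to `a`: in every orthonormal (Hilbert) basis the diagonal of `T` is
summable, with sum `a`. -/
def HasTrace {H : Type} [NormedAddCommGroup H] [InnerProductSpace ℂ H] [CompleteSpace H]
    (T : H →L[ℂ] H) (a : ℂ) : Prop :=
  ∀ (β : Type) (b : HilbertBasis β ℂ H), HasSum (fun i => inner ℂ (b i) (T (b i))) a

/-- Density operators: positive operators of trace one. -/
def IsDensityOperator {H : Type} [NormedAddCommGroup H] [InnerProductSpace ℂ H] [CompleteSpace H]
    (ρ : H →L[ℂ] H) : Prop :=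
  ρ.IsPositive ∧ HasTrace ρ 1

/-- POVM elements (effects): operators `E` with `0 ≤ E ≤ 1`. -/
def IsEffect {H : Type} [NormedAddCommGroup H] [InnerProductSpace ℂ H] [CompleteSpace H]
    (E : H →L[ℂ] H) : Prop :=
  E.IsPositive ∧ (1 - E).IsPositive

/-- `τ` is the state of the modes `ι` obtained from the state `ρ` of the modes `ι ⊕ κ` by
post-selecting the modes `κ` on the POVM element `E`, which happens with probability `p > 0`:
`p • τ = Tr_κ (ρ (1 ⊗ E))`, in matrix elements
`p ⟨f, τ f'⟩ = ∑ⱼ ⟨f ⊗ bⱼ, ρ (f' ⊗ E bⱼ)⟩` for orthonormal bases `b` of the space of the modes `κ`.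
As `τ` has trace one, `p = Tr (ρ (1 ⊗ E))`. -/
structure IsPostselection (ρ : ModeSpace (ι ⊕ κ) →L[ℂ] ModeSpace (ι ⊕ κ))
    (E : ModeSpace κ →L[ℂ] ModeSpace κ) (p : ℝ) (τ : ModeSpace ι →L[ℂ] ModeSpace ι) : Prop where
  effect : IsEffect E
  prob_pos : 0 < p
  density : IsDensityOperator τ
  partialTrace : ∀ (f f' : ModeSpace ι) (β : Type) (b : HilbertBasis β ℂ (ModeSpace κ)),
    HasSum (fun j => inner ℂ (prodVec f (b j)) (ρ (prodVec f' (E (b j)))))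
      ((p : ℂ) * inner ℂ f (τ f'))

/-! ## Gaussian states -/

/-- The one-mode symplectic form `Ω₁`. -/
def Omega1 : Matrix (Fin 2) (Fin 2) ℝ := !![0, 1; -1, 0]

/-- The symplectic form `⨁ Ω₁` (one summand for each mode), phase space being ordered as
`Q₁, P₁, Q₂, P₂, …`. -/
def Omega (ι : Type) [DecidableEq ι] : Matrix (ι × Fin 2) (ι × Fin 2) ℝ :=
  Matrix.kronecker (1 : Matrix ι ι ℝ) Omega1

/-- `ρ` is a Gaussian density operator with mean vector `μ` and covariance matrix `S`: its
characteristic function is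
`Tr (ρ D_v) = exp(-(1/(2ħ²)) (Ωv)ᵀ S (Ωv) + (i/ħ) (Ωv)ᵀ μ)`.
The covariance of the vacuum is `(ħ/2) 1`. -/
structure IsGaussianState [DecidableEq ι] (ħ : ℝ) (ρ : ModeSpace ι →L[ℂ] ModeSpace ι)
    (μ : ι × Fin 2 → ℝ) (S : Matrix (ι × Fin 2) (ι × Fin 2) ℝ) : Prop where
  density : IsDensityOperator ρ
  symm : S.IsSymm
  charFun : ∀ v : ι × Fin 2 → ℝ, HasTrace (ρ ∘L displacement ħ v)
    (Complex.exp (((-(1 / (2 * ħ ^ 2)) * ((Omega ι *ᵥ v) ⬝ᵥ (S *ᵥ (Omega ι *ᵥ v))) : ℝ) : ℂ)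
      + ((ħ⁻¹ * ((Omega ι *ᵥ v) ⬝ᵥ μ) : ℝ) : ℂ) * I))

/-! ## The semidefinite program -/

/-- `Z ⊕ 0` for a matrix `Z` on the first of `1 + n` modes. -/
def firstBlock (n : ℕ) (Z : Matrix (Fin 2) (Fin 2) ℂ) :
    Matrix ((Unit ⊕ Fin n) × Fin 2) ((Unit ⊕ Fin n) × Fin 2) ℂ :=
  Matrix.of fun a b => match a, b with
    | (Sum.inl _, i), (Sum.inl _, j) => Z i j
    | _, _ => 0

/-- `0 ⊕ W` for a matrix `W` on the last `n` of `1 + n` modes. -/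
def lastBlock (n : ℕ) (W : Matrix (Fin n × Fin 2) (Fin n × Fin 2) ℂ) :
    Matrix ((Unit ⊕ Fin n) × Fin 2) ((Unit ⊕ Fin n) × Fin 2) ℂ :=
  Matrix.of fun a b => match a, b with
    | (Sum.inr k, i), (Sum.inr l, j) => W (k, i) (l, j)
    | _, _ => 0

/-- The feasible set: Hermitian `Z` with `Z ≥ i(ħ/2)Ω₁` and
`S + s (0 ⊕ i(ħ/2)Ωₙ) ≥ Z ⊕ 0`, where `s = ±1` is a sign. -/
def sdpFeasible (ħ : ℝ) (n : ℕ) (s : ℝ)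
    (S : Matrix ((Unit ⊕ Fin n) × Fin 2) ((Unit ⊕ Fin n) × Fin 2) ℝ) :
    Set (Matrix (Fin 2) (Fin 2) ℂ) :=
  {Z | Z.IsHermitian ∧
    (Z - (I * ħ / 2) • Omega1.map Complex.ofReal).PosSemidef ∧
    (S.map Complex.ofReal
      + (s : ℂ) • lastBlock n ((I * ħ / 2) • (Omega (Fin n)).map Complex.ofReal)
      - firstBlock n Z).PosSemidef}

/-- The objective `(1/(πħ²)) (Ω₁v)ᵀ Z (Ω₁v)`, a real number for Hermitian `Z`. -/
def sdpObjective (ħ : ℝ) (v : Fin 2 → ℝ) (Z : Matrix (Fin 2) (Fin 2) ℂ) : ℝ :=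
  1 / (Real.pi * ħ ^ 2) *
    ((fun i => (((Omega1 *ᵥ v) i : ℝ) : ℂ)) ⬝ᵥ
      (Z *ᵥ fun i => (((Omega1 *ᵥ v) i : ℝ) : ℂ))).re

/-- The value of the program, `-∞` if it is infeasible. -/
def sdpValue (ħ : ℝ) (n : ℕ) (s : ℝ)
    (S : Matrix ((Unit ⊕ Fin n) × Fin 2) ((Unit ⊕ Fin n) × Fin 2) ℝ) (v : Fin 2 → ℝ) : EReal :=
  ⨆ Z ∈ sdpFeasible ħ n s S, ((sdpObjective ħ v Z : ℝ) : EReal)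

/-- The effective squeezing parameter `σ² = (2/π) log (1/|t|) ∈ [0, ∞]` that belongs to a
stabilizer expectation value `t = Tr (τ D_v)`. -/
def effectiveSqueezing (t : ℂ) : EReal :=
  ((2 / Real.pi : ℝ) : EReal) * ENNReal.log (‖t‖ₑ)⁻¹

/-- The displacement `D_v`, `v ∈ ℝ²`, of a single mode. -/
def displacement1 (ħ : ℝ) (v : Fin 2 → ℝ) : ModeSpace Unit →L[ℂ] ModeSpace Unit :=
  displacement ħ fun a => v a.2

end CVQuantum

end

/-! Write ρ = A² with A self-adjoint, hence Hilbert–Schmidt. The family ξ = (A bᵢ) in ℓ²(β; H)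
purifies ρ: the expectation of D_y in ξ, acting on each component, is Tr (ρ D_y). The Gaussian
characteristic function therefore determines all inner products between displaced copies of ξ.

The core is a bound on |⟨η, D_v η⟩| for η in the closed span of the orbit of ξ under displacements
of the last n modes (`norm_inner_amplify_displacement_le`). At the points y_p = (r_p v, u_p) the
kernel ⟨D_{y_p} ξ, D_{y_q} ξ⟩ is, up to a rank-one factor, the entrywise exponential of 1/ħ² times
the form S + i(ħ/2)(0 ⊕ Ωₙ). The first mode adds no symplectic term because its displacements are
all parallel. The constraint says that the form stays positive after subtraction of Z ⊕ 0. By the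
Schur product theorem the kernel then stays positive definite when multiplied by exp(z (r_p -
r_q)²/(2ħ²)), where z = (Ω₁v)ᵀ Z (Ω₁v) (`re_sum_inner_mul_exp_nonneg`). Testing it with r = 0 and r
= 1 gives the bound.

A non-Gaussian E is reached because displacements generate everything: a Gaussian average of them is
a multiple of |φ⟩⟨φ| with φ the Gaussian vector, and the displaced copies of φ are total, so the
closed span contains (1 ⊗ |φ⟩⟨h|) ξ for every h (`rankOneOrbit_mem_closure`). With E = K², the
number p Tr (τ D_v) is a sum of slices with h = K dⱼ (`IsPostselection.hasSum_sliceTrace`). Each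
slice obeys the bound, and the same slices with D_v replaced by 1 add up to p.

The sign -1 reduces to +1 by transposition. The maximum exists by compactness
(`isCompact_sdpFeasible`); feasibility of Z = i(ħ/2)Ω₁ is the uncertainty relation
(`uncertainty_relation`), the infinitesimal form of the positivity of the same kernel. -/

noncomputable section

open MeasureTheory Complex
open scoped Matrix ComplexOrder ENNReal InnerProductSpace

set_option linter.unusedSectionVars false

namespace CVQuantum

/-! ### Hilbert–Schmidt operators and traces. -/

section HilbertSchmidt

variable {H H' : Type} [NormedAddCommGroup H] [InnerProductSpace ℂ H] [CompleteSpace H]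
  [NormedAddCommGroup H'] [InnerProductSpace ℂ H'] [CompleteSpace H'] {β γ : Type}

/-- The diagonal sum of `X† X` in the basis `b` is finite. -/
def HilbertSchmidtOn (b : HilbertBasis β ℂ H) (X : H →L[ℂ] H') : Prop :=
  Summable fun i => ‖X (b i)‖ ^ 2

theorem inner_self_eq_ofReal (x : H) : ⟪x, x⟫_ℂ = ((‖x‖ ^ 2 : ℝ) : ℂ) := by
  rw [inner_self_eq_norm_sq_to_K]
  norm_cast

theorem hasSum_sq_norm_inner (e : HilbertBasis γ ℂ H) (x : H) :
    HasSum (fun j => ‖⟪x, e j⟫_ℂ‖ ^ 2) (‖x‖ ^ 2) := by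
  have h := e.hasSum_inner_mul_inner x x
  have h2 := (Complex.hasSum_re h)
  simp only [inner_self_eq_norm_sq_to_K] at h2
  convert h2 using 1
  · funext j
    rw [← inner_conj_symm (e j) x, Complex.mul_conj, Complex.normSq_eq_norm_sq, Complex.ofReal_re]
  · norm_cast

theorem hasSum_prod_sq_norm_inner {b : HilbertBasis β ℂ H} {X : H →L[ℂ] H'}
    (hX : HilbertSchmidtOn b X) (e : HilbertBasis γ ℂ H') :
    Summable fun q : β × γ => ‖⟪X (b q.1), e q.2⟫_ℂ‖ ^ 2 := by
  rw [summable_prod_of_nonneg (fun _ => by positivity)]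
  refine ⟨fun i => (hasSum_sq_norm_inner e (X (b i))).summable, ?_⟩
  simp only [(hasSum_sq_norm_inner e _).tsum_eq]
  exact hX

/-- Since |xy| ≤ |x|² + |y|², Parseval in `e` gives absolute summability over pairs, which licenses
the exchange of the two sums in the cyclicity of the trace. -/
theorem summable_prod_inner_mul_inner {b : HilbertBasis β ℂ H} {X Y : H →L[ℂ] H'}
    (hX : HilbertSchmidtOn b X) (hY : HilbertSchmidtOn b Y) (e : HilbertBasis γ ℂ H') :
    Summable fun q : β × γ => ⟪X (b q.1), e q.2⟫_ℂ * ⟪e q.2, Y (b q.1)⟫_ℂ := by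
  refine Summable.of_norm_bounded
    ((hasSum_prod_sq_norm_inner hX e).add (hasSum_prod_sq_norm_inner hY e)) fun q => ?_
  rw [norm_mul, norm_inner_symm (e q.2)]
  nlinarith [sq_nonneg (‖⟪X (b q.1), e q.2⟫_ℂ‖ - ‖⟪Y (b q.1), e q.2⟫_ℂ‖),
    sq_nonneg ‖⟪X (b q.1), e q.2⟫_ℂ‖, sq_nonneg ‖⟪Y (b q.1), e q.2⟫_ℂ‖]

theorem HilbertSchmidtOn.summable_inner {b : HilbertBasis β ℂ H} {X Y : H →L[ℂ] H'}
    (hX : HilbertSchmidtOn b X) (hY : HilbertSchmidtOn b Y) :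
    Summable fun i => ⟪X (b i), Y (b i)⟫_ℂ := by
  refine Summable.of_norm_bounded (hX.add hY) fun i => ?_
  refine (norm_inner_le_norm _ _).trans ?_
  nlinarith [sq_nonneg (‖X (b i)‖ - ‖Y (b i)‖), sq_nonneg ‖X (b i)‖, sq_nonneg ‖Y (b i)‖]

/-- The Hilbert–Schmidt inner product of `X` and `Y` is that of `Y†` and `X†`. -/
theorem HilbertSchmidtOn.hasSum_inner_adjoint {b : HilbertBasis β ℂ H} {X Y : H →L[ℂ] H'}
    (hX : HilbertSchmidtOn b X) (hY : HilbertSchmidtOn b Y) (e : HilbertBasis γ ℂ H') :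
    HasSum (fun j => ⟪ContinuousLinearMap.adjoint Y (e j), ContinuousLinearMap.adjoint X (e j)⟫_ℂ)
      (∑' i, ⟪X (b i), Y (b i)⟫_ℂ) := by
  have hs := summable_prod_inner_mul_inner hX hY e
  have h1 : ∑' i, ⟪X (b i), Y (b i)⟫_ℂ
      = ∑' q : β × γ, ⟪X (b q.1), e q.2⟫_ℂ * ⟪e q.2, Y (b q.1)⟫_ℂ := by
    rw [hs.tsum_prod]
    exact tsum_congr fun i => ((e.hasSum_inner_mul_inner _ _).tsum_eq).symm
  rw [h1]
  have h2 := (Equiv.prodComm γ β).hasSum_iff.2 hs.hasSum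
  refine h2.prod_fiberwise fun j => ?_
  have h3 : (fun i => ⟪ContinuousLinearMap.adjoint Y (e j), b i⟫_ℂ
      * ⟪b i, ContinuousLinearMap.adjoint X (e j)⟫_ℂ)
      = fun i => ((fun q : β × γ => ⟪X (b q.1), e q.2⟫_ℂ * ⟪e q.2, Y (b q.1)⟫_ℂ) ∘
        Equiv.prodComm γ β) (j, i) := by
    funext i
    rw [ContinuousLinearMap.adjoint_inner_left, ContinuousLinearMap.adjoint_inner_right, mul_comm]
    rfl
  rw [← h3]
  exact b.hasSum_inner_mul_inner _ _

theorem HilbertSchmidtOn.adjoint {b : HilbertBasis β ℂ H} {X : H →L[ℂ] H'}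
    (hX : HilbertSchmidtOn b X) (e : HilbertBasis γ ℂ H') :
    HilbertSchmidtOn e (ContinuousLinearMap.adjoint X) := by
  have h := Complex.hasSum_re (hX.hasSum_inner_adjoint hX e)
  refine h.summable.congr fun j => ?_
  rw [inner_self_eq_norm_sq_to_K]
  norm_cast

theorem HilbertSchmidtOn.comp_left {H₂ : Type} [NormedAddCommGroup H₂] [InnerProductSpace ℂ H₂]
    {b : HilbertBasis β ℂ H} {X : H →L[ℂ] H'} (hX : HilbertSchmidtOn b X) (C : H' →L[ℂ] H₂) :
    HilbertSchmidtOn b (C ∘L X) := by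
  refine Summable.of_nonneg_of_le (fun _ => by positivity) (fun i => ?_) (hX.mul_left (‖C‖ ^ 2))
  rw [← mul_pow]
  gcongr
  exact C.le_opNorm _

/-- Right multiplication is left multiplication by C† after passing to adjoints; left multiplication
is bounded termwise. -/
theorem HilbertSchmidtOn.comp_right {H₀ : Type} [NormedAddCommGroup H₀] [InnerProductSpace ℂ H₀]
    [CompleteSpace H₀] {b : HilbertBasis β ℂ H} {X : H →L[ℂ] H'} (hX : HilbertSchmidtOn b X)
    (C : H₀ →L[ℂ] H) (d : HilbertBasis γ ℂ H₀) : HilbertSchmidtOn d (X ∘L C) := by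
  obtain ⟨w, e, -⟩ := exists_hilbertBasis ℂ H'
  have h := ((hX.adjoint e).comp_left (ContinuousLinearMap.adjoint C)).adjoint d
  rwa [ContinuousLinearMap.adjoint_comp, ContinuousLinearMap.adjoint_adjoint,
    ContinuousLinearMap.adjoint_adjoint] at h

/-- The Hilbert–Schmidt inner product does not depend on the basis. -/
theorem HilbertSchmidtOn.hasSum_inner {b : HilbertBasis β ℂ H} {X Y : H →L[ℂ] H'}
    (hX : HilbertSchmidtOn b X) (hY : HilbertSchmidtOn b Y) (d : HilbertBasis γ ℂ H) :
    HasSum (fun j => ⟪X (d j), Y (d j)⟫_ℂ) (∑' i, ⟪X (b i), Y (b i)⟫_ℂ) := by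
  obtain ⟨w, e, -⟩ := exists_hilbertBasis ℂ H'
  have h := (hY.adjoint e).hasSum_inner_adjoint (hX.adjoint e) d
  rw [(hX.hasSum_inner_adjoint hY e).tsum_eq] at h
  simpa only [ContinuousLinearMap.adjoint_adjoint] using h

theorem _root_.ContinuousLinearMap.IsPositive.exists_sqrt {T : H →L[ℂ] H} (hT : T.IsPositive) :
    ∃ A : H →L[ℂ] H, ContinuousLinearMap.adjoint A = A ∧ A ∘L A = T := by
  have h0 : (0 : H →L[ℂ] H) ≤ T := (ContinuousLinearMap.nonneg_iff_isPositive T).2 hT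
  refine ⟨CFC.sqrt T, ?_, CFC.sqrt_mul_sqrt_self T h0⟩
  have h1 : IsSelfAdjoint (CFC.sqrt T) := IsSelfAdjoint.of_nonneg (CFC.sqrt_nonneg T)
  exact h1

theorem inner_apply_comp_self {A : H →L[ℂ] H} (hA : ContinuousLinearMap.adjoint A = A) (x y : H) :
    ⟪x, A (A y)⟫_ℂ = ⟪A x, A y⟫_ℂ := by
  conv_rhs => rw [← hA, ContinuousLinearMap.adjoint_inner_left, hA]

/-- The square root of a density operator is Hilbert–Schmidt. -/
theorem IsDensityOperator.exists_sqrt {ρ : H →L[ℂ] H} (hρ : IsDensityOperator ρ) :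
    ∃ A : H →L[ℂ] H, ContinuousLinearMap.adjoint A = A ∧ A ∘L A = ρ ∧
      ∀ (β : Type) (b : HilbertBasis β ℂ H), HilbertSchmidtOn b A := by
  obtain ⟨A, hA, hAA⟩ := hρ.1.exists_sqrt
  refine ⟨A, hA, hAA, fun β b => ?_⟩
  refine (Complex.hasSum_re (hρ.2 β b)).summable.congr fun i => ?_
  rw [← hAA, ContinuousLinearMap.comp_apply, inner_apply_comp_self hA, inner_self_eq_norm_sq_to_K]
  norm_cast

/-- With ρ = A², the diagonal sum is the Hilbert–Schmidt inner product of A and A D, which is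
independent of the basis. -/
theorem IsDensityOperator.exists_hasTrace_comp {ρ : H →L[ℂ] H} (hρ : IsDensityOperator ρ)
    (D : H →L[ℂ] H) : ∃ t, HasTrace (ρ ∘L D) t := by
  obtain ⟨A, hA, rfl, hs⟩ := hρ.exists_sqrt
  obtain ⟨w, b, -⟩ := exists_hilbertBasis ℂ H
  refine ⟨∑' i, ⟪A (b i), (A ∘L D) (b i)⟫_ℂ, fun β d => ?_⟩
  convert (hs _ b).hasSum_inner ((hs _ b).comp_right D b) d using 2 with j
  simp only [ContinuousLinearMap.comp_apply, inner_apply_comp_self hA]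

/-- `Tr (A² D)` as an expectation value in the vectors `A bᵢ`. -/
theorem hasSum_inner_of_hasTrace {A D : H →L[ℂ] H} {b : HilbertBasis β ℂ H}
    (hA : ContinuousLinearMap.adjoint A = A) (hs : HilbertSchmidtOn b A) {t : ℂ}
    (ht : HasTrace ((A ∘L A) ∘L D) t) :
    HasSum (fun i => ⟪A (b i), D (A (b i))⟫_ℂ) t := by
  have h1 := hs.hasSum_inner_adjoint (hs.comp_right D b) b
  have h2 : ∑' i, ⟪A (b i), (A ∘L D) (b i)⟫_ℂ = t := by
    rw [← (ht β b).tsum_eq]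
    simp only [ContinuousLinearMap.comp_apply, inner_apply_comp_self hA]
  rw [h2] at h1
  convert h1 using 2 with i
  rw [ContinuousLinearMap.adjoint_comp, hA, ContinuousLinearMap.comp_apply,
    ContinuousLinearMap.adjoint_inner_left]

/-- Basis vectors lie at distance √2, so balls of radius 1/2 around them are disjoint. Countability
is needed to exchange sums over the basis with integrals. -/
theorem _root_.HilbertBasis.countable_index [SecondCountableTopology H]
    (b : HilbertBasis β ℂ H) : Countable β := by
  have h : Pairwise fun i j => Disjoint (Metric.ball (b i) (1 / 2)) (Metric.ball (b j) (1 / 2)) := by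
    intro i j hij
    refine Metric.ball_disjoint_ball ?_
    have h0 : ⟪b i, b j⟫_ℂ = 0 := b.orthonormal.2 hij
    have h1 : ‖b i - b j‖ ^ 2 = 2 := by
      rw [@norm_sub_sq ℂ, h0, b.orthonormal.1, b.orthonormal.1]
      norm_num
    rw [dist_eq_norm]
    nlinarith [norm_nonneg (b i - b j)]
  exact h.countable_of_isOpen_disjoint (fun _ => Metric.isOpen_ball)
    fun i => ⟨b i, Metric.mem_ball_self (by norm_num)⟩

end HilbertSchmidt

/-! ### Weyl relations and product vectors. -/

section Displacement

variable {ι κ : Type} [Fintype ι] [Fintype κ]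

/-- The symplectic form `∑ⱼ (aⱼ b'ⱼ - bⱼ a'ⱼ)`. -/
def sympl (u w : ι × Fin 2 → ℝ) : ℝ := ∑ j, (u (j, 0) * w (j, 1) - u (j, 1) * w (j, 0))

/-- The Weyl relation: the half-products a·b/2 in the phases combine to half the symplectic form. -/
theorem displacement_comp (ħ : ℝ) (u w : ι × Fin 2 → ℝ) (ψ : ModeSpace ι) :
    displacement ħ u (displacement ħ w ψ)
      = Complex.exp (((-(ħ⁻¹ * sympl u w / 2) : ℝ) : ℂ) * I) • displacement ħ (u + w) ψ := by
  apply Lp.ext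
  have h1 := (displacement_measurePreserving u).quasiMeasurePreserving.ae
    (displacement_coeFn ħ w ψ)
  filter_upwards [displacement_coeFn ħ u (displacement ħ w ψ), displacement_coeFn ħ (u + w) ψ,
    Lp.coeFn_smul (Complex.exp (((-(ħ⁻¹ * sympl u w / 2) : ℝ) : ℂ) * I))
      (displacement ħ (u + w) ψ), h1] with x h2 h3 h4 h5
  rw [h2, h4, Pi.smul_apply, h3]
  simp only [displacementFun] at h5 ⊢
  rw [h5, smul_eq_mul, ← mul_assoc, ← mul_assoc]
  have hx : (x - (fun j => u (j, 0)) - fun j => w (j, 0)) = x - fun j => (u + w) (j, 0) := by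
    funext j; simp only [Pi.sub_apply, Pi.add_apply]; ring
  rw [hx]
  congr 1
  simp only [displacementPhase]
  rw [← Complex.exp_add, ← Complex.exp_add, ← add_mul, ← add_mul]
  congr 2
  norm_cast
  rw [← mul_add, ← Finset.sum_add_distrib, sympl, mul_div_assoc, ← mul_neg, ← mul_add,
    Finset.sum_div, ← Finset.sum_neg_distrib, ← Finset.sum_add_distrib]
  congr 1
  refine Finset.sum_congr rfl fun j _ => ?_
  simp only [Pi.sub_apply, Pi.add_apply]
  ring

theorem sympl_neg_self (u : ι × Fin 2 → ℝ) : sympl (-u) u = 0 :=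
  Finset.sum_eq_zero fun j _ => by simp only [Pi.neg_apply]; ring

theorem sympl_self_neg (u : ι × Fin 2 → ℝ) : sympl u (-u) = 0 :=
  Finset.sum_eq_zero fun j _ => by simp only [Pi.neg_apply]; ring

theorem displacement_zero (ħ : ℝ) (ψ : ModeSpace ι) : displacement ħ 0 ψ = ψ := by
  apply Lp.ext
  filter_upwards [displacement_coeFn ħ 0 ψ] with x h
  rw [h, displacementFun, displacementPhase]
  have : (x - fun j : ι => (0 : ι × Fin 2 → ℝ) (j, 0)) = x := by funext j; simp
  rw [this]
  simp

theorem displacement_neg_comp (ħ : ℝ) (u : ι × Fin 2 → ℝ) (ψ : ModeSpace ι) :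
    displacement ħ (-u) (displacement ħ u ψ) = ψ := by
  rw [displacement_comp, sympl_neg_self]
  simp [displacement_zero]

theorem displacement_comp_neg (ħ : ℝ) (u : ι × Fin 2 → ℝ) (ψ : ModeSpace ι) :
    displacement ħ u (displacement ħ (-u) ψ) = ψ := by
  rw [displacement_comp, sympl_self_neg]
  simp [displacement_zero]

theorem norm_displacement_le (ħ : ℝ) (u : ι × Fin 2 → ℝ) (ψ : ModeSpace ι) :
    ‖displacement ħ u ψ‖ ≤ ‖ψ‖ := by
  refine ((displacement ħ u).le_of_opNorm_le (c := 1) ?_ ψ).trans_eq (one_mul _)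
  exact LinearMap.mkContinuous_norm_le _ zero_le_one _

theorem norm_displacement (ħ : ℝ) (u : ι × Fin 2 → ℝ) (ψ : ModeSpace ι) :
    ‖displacement ħ u ψ‖ = ‖ψ‖ := by
  refine le_antisymm (norm_displacement_le ħ u ψ) ?_
  conv_lhs => rw [← displacement_neg_comp ħ u ψ]
  exact norm_displacement_le ħ _ _

/-- The displacement operator as a unitary. -/
def displacementEquiv (ħ : ℝ) (u : ι × Fin 2 → ℝ) : ModeSpace ι ≃ₗᵢ[ℂ] ModeSpace ι where
  toFun := displacement ħ u
  invFun := displacement ħ (-u)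
  map_add' := map_add _
  map_smul' := map_smul _
  left_inv := displacement_neg_comp ħ u
  right_inv := displacement_comp_neg ħ u
  norm_map' := norm_displacement ħ u

theorem inner_displacement_displacement (ħ : ℝ) (u : ι × Fin 2 → ℝ) (ψ χ : ModeSpace ι) :
    ⟪displacement ħ u ψ, displacement ħ u χ⟫_ℂ = ⟪ψ, χ⟫_ℂ :=
  (displacementEquiv ħ u).inner_map_map ψ χ

theorem inner_displacement_left (ħ : ℝ) (u : ι × Fin 2 → ℝ) (ψ χ : ModeSpace ι) :
    ⟪displacement ħ u ψ, χ⟫_ℂ = ⟪ψ, displacement ħ (-u) χ⟫_ℂ := by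
  conv_lhs => rw [← displacement_comp_neg ħ u χ, inner_displacement_displacement]

theorem adjoint_displacement (ħ : ℝ) (u : ι × Fin 2 → ℝ) :
    ContinuousLinearMap.adjoint (displacement ħ u) = displacement ħ (-u) := by
  symm
  rw [ContinuousLinearMap.eq_adjoint_iff]
  intro x y
  rw [inner_displacement_left, neg_neg]

/-! ### Product vectors -/

theorem inner_prodVec (f f' : ModeSpace ι) (g g' : ModeSpace κ) :
    ⟪prodVec f g, prodVec f' g'⟫_ℂ = ⟪f, f'⟫_ℂ * ⟪g, g'⟫_ℂ := by
  have hmp := volume_measurePreserving_sumPiEquivProdPi (fun _ : ι ⊕ κ => ℝ)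
  rw [L2.inner_def, L2.inner_def, L2.inner_def, ← integral_prod_mul]
  rw [← Measure.volume_eq_prod, ← hmp.integral_comp (MeasurableEquiv.measurableEmbedding _)]
  refine integral_congr_ae ?_
  filter_upwards [prodVec_coeFn f g, prodVec_coeFn f' g'] with z h h'
  rw [h, h']
  simp only [prodFun, RCLike.inner_apply, map_mul]
  exact mul_mul_mul_comm _ _ _ _

theorem norm_prodVec (f : ModeSpace ι) (g : ModeSpace κ) : ‖prodVec f g‖ = ‖f‖ * ‖g‖ := by
  have h := inner_prodVec f f g g
  simp only [inner_self_eq_norm_sq_to_K] at h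
  have h2 : ‖prodVec f g‖ ^ 2 = (‖f‖ * ‖g‖) ^ 2 := by
    rw [mul_pow]; exact_mod_cast h
  exact (sq_eq_sq₀ (norm_nonneg _) (by positivity)).1 h2

/-- Lets the bilinearity of `prodVec` follow from `inner_prodVec` by expanding the squared norm of a
difference, without almost-everywhere representatives. -/
theorem eq_of_inner_self_sub_eq_zero {H : Type} [NormedAddCommGroup H] [InnerProductSpace ℂ H]
    {x y : H} (h : ⟪x - y, x - y⟫_ℂ = 0) : x = y :=
  sub_eq_zero.1 (inner_self_eq_zero.1 h)

theorem prodVec_add_left (f f' : ModeSpace ι) (g : ModeSpace κ) :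
    prodVec (f + f') g = prodVec f g + prodVec f' g := by
  apply eq_of_inner_self_sub_eq_zero
  simp only [inner_sub_left, inner_sub_right, inner_add_left, inner_add_right, inner_prodVec]
  ring

theorem prodVec_add_right (f : ModeSpace ι) (g g' : ModeSpace κ) :
    prodVec f (g + g') = prodVec f g + prodVec f g' := by
  apply eq_of_inner_self_sub_eq_zero
  simp only [inner_sub_left, inner_sub_right, inner_add_left, inner_add_right, inner_prodVec]
  ring

theorem prodVec_smul_left (c : ℂ) (f : ModeSpace ι) (g : ModeSpace κ) :
    prodVec (c • f) g = c • prodVec f g := by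
  apply eq_of_inner_self_sub_eq_zero
  simp only [inner_sub_left, inner_sub_right, inner_smul_left, inner_smul_right, inner_prodVec]
  ring

theorem prodVec_smul_right (c : ℂ) (f : ModeSpace ι) (g : ModeSpace κ) :
    prodVec f (c • g) = c • prodVec f g := by
  apply eq_of_inner_self_sub_eq_zero
  simp only [inner_sub_left, inner_sub_right, inner_smul_left, inner_smul_right, inner_prodVec]
  ring

/-- The map `f ↦ f ⊗ g`. -/
def tensorRight (g : ModeSpace κ) : ModeSpace ι →L[ℂ] ModeSpace (ι ⊕ κ) :=
  LinearMap.mkContinuous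
    { toFun := fun f => prodVec f g
      map_add' := fun f f' => prodVec_add_left f f' g
      map_smul' := fun c f => prodVec_smul_left c f g } ‖g‖
    fun f => (norm_prodVec f g).trans_le (mul_comm _ _).le

/-- The map `g ↦ f ⊗ g`. -/
def tensorLeft (f : ModeSpace ι) : ModeSpace κ →L[ℂ] ModeSpace (ι ⊕ κ) :=
  LinearMap.mkContinuous
    { toFun := fun g => prodVec f g
      map_add' := fun g g' => prodVec_add_right f g g'
      map_smul' := fun c g => prodVec_smul_right c f g } ‖f‖
    fun g => (norm_prodVec f g).le

@[simp]
theorem tensorRight_apply (g : ModeSpace κ) (f : ModeSpace ι) : tensorRight g f = prodVec f g := rfl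

theorem adjoint_tensorRight_prodVec (h g : ModeSpace κ) (f : ModeSpace ι) :
    ContinuousLinearMap.adjoint (tensorRight h) (prodVec f g) = (⟪h, g⟫_ℂ : ℂ) • f := by
  refine ext_inner_left ℂ fun x => ?_
  rw [ContinuousLinearMap.adjoint_inner_right, tensorRight_apply, inner_prodVec,
    inner_smul_right, mul_comm]

/-- The phase space vector with components `v` and `u` on the two subsystems. -/
def joinModes (v : ι × Fin 2 → ℝ) (u : κ × Fin 2 → ℝ) : (ι ⊕ κ) × Fin 2 → ℝ :=
  fun a => Sum.elim (fun j => v (j, a.2)) (fun k => u (k, a.2)) a.1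

theorem displacement_prodVec (ħ : ℝ) (v : ι × Fin 2 → ℝ) (u : κ × Fin 2 → ℝ)
    (f : ModeSpace ι) (g : ModeSpace κ) :
    displacement ħ (joinModes v u) (prodVec f g)
      = prodVec (displacement ħ v f) (displacement ħ u g) := by
  have hmp := volume_measurePreserving_sumPiEquivProdPi (fun _ : ι ⊕ κ => ℝ)
  have hl : Measure.QuasiMeasurePreserving (fun z : ι ⊕ κ → ℝ => fun i => z (Sum.inl i))
      volume volume := Measure.quasiMeasurePreserving_fst.comp hmp.quasiMeasurePreserving
  have hr : Measure.QuasiMeasurePreserving (fun z : ι ⊕ κ → ℝ => fun k => z (Sum.inr k))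
      volume volume := Measure.quasiMeasurePreserving_snd.comp hmp.quasiMeasurePreserving
  apply Lp.ext
  filter_upwards [displacement_coeFn ħ (joinModes v u) (prodVec f g),
    prodVec_coeFn (displacement ħ v f) (displacement ħ u g),
    (displacement_measurePreserving (joinModes v u)).quasiMeasurePreserving.ae
      (prodVec_coeFn f g), hl.ae (displacement_coeFn ħ v f),
    hr.ae (displacement_coeFn ħ u g)] with z h1 h2 h3 h4 h5
  rw [h1, h2, displacementFun, h3]
  simp only [prodFun]
  rw [h4, h5]
  simp only [displacementFun]
  rw [mul_mul_mul_comm]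
  congr 1
  simp only [displacementPhase]
  rw [← Complex.exp_add, ← add_mul]
  congr 2
  norm_cast
  rw [← mul_add, Fintype.sum_sum_type]
  rfl

theorem joinModes_add (v v' : ι × Fin 2 → ℝ) (u u' : κ × Fin 2 → ℝ) :
    joinModes v u + joinModes v' u' = joinModes (v + v') (u + u') := by
  funext ⟨a, i⟩
  cases a <;> rfl

theorem joinModes_neg (v : ι × Fin 2 → ℝ) (u : κ × Fin 2 → ℝ) :
    -joinModes v u = joinModes (-v) (-u) := by
  funext ⟨a, i⟩
  cases a <;> rfl

theorem sympl_joinModes (v v' : ι × Fin 2 → ℝ) (u u' : κ × Fin 2 → ℝ) :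
    sympl (joinModes v u) (joinModes v' u') = sympl v v' + sympl u u' := by
  unfold sympl
  rw [Fintype.sum_sum_type]
  rfl

end Displacement

/-! ### Injectivity of the Fourier transform on integrable functions. -/

section FourierUniqueness

variable {κ : Type} [Fintype κ]

/-- The positive and negative parts of f are densities of finite measures with equal characteristic
functions. The measures coincide, so both parts agree almost everywhere and f vanishes. -/
theorem ae_eq_zero_of_fourier_eq_zero_real {f : (κ → ℝ) → ℝ} (hf : Integrable f)
    (h : ∀ b : κ → ℝ, ∫ y, Complex.exp ((∑ j, b j * y j : ℝ) * I) * f y = 0) :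
    f =ᵐ[volume] 0 := by
  classical
  have hexp : ∀ (L : (κ → ℝ) → ℝ) (y), ‖Complex.exp ((L y : ℂ) * I)‖ = 1 := fun L y =>
    Complex.norm_exp_ofReal_mul_I _
  have hp : AEMeasurable (fun y => ENNReal.ofReal (f y)) volume := hf.aemeasurable.ennreal_ofReal
  have hn : AEMeasurable (fun y => ENNReal.ofReal (-f y)) volume :=
    hf.neg.aemeasurable.ennreal_ofReal
  have hfp : ∫⁻ y, ENNReal.ofReal (f y) ≠ ∞ := hf.lintegral_lt_top.ne
  have hfn : ∫⁻ y, ENNReal.ofReal (-f y) ≠ ∞ := hf.neg.lintegral_lt_top.ne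
  have : IsFiniteMeasure (volume.withDensity fun y => ENNReal.ofReal (f y)) :=
    isFiniteMeasure_withDensity hfp
  have : IsFiniteMeasure (volume.withDensity fun y => ENNReal.ofReal (-f y)) :=
    isFiniteMeasure_withDensity hfn
  have key : (volume.withDensity fun y => ENNReal.ofReal (f y))
      = volume.withDensity fun y => ENNReal.ofReal (-f y) := by
    refine Measure.ext_of_charFunDual ?_
    ext L
    rw [charFunDual_apply, charFunDual_apply,
      integral_withDensity_eq_integral_toReal_smul₀ hp (by simp),
      integral_withDensity_eq_integral_toReal_smul₀ hn (by simp), ← sub_eq_zero]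
    have hL : ∀ y, L y = ∑ j, L (Pi.single j 1) * y j := by
      intro y
      conv_lhs => rw [pi_eq_sum_univ' y]
      rw [map_sum]
      refine Finset.sum_congr rfl fun j _ => ?_
      rw [map_smul, smul_eq_mul, mul_comm]
    have hLm : AEStronglyMeasurable (fun y => Complex.exp ((L y : ℂ) * I)) volume := by
      apply Continuous.aestronglyMeasurable
      fun_prop
    have hi : ∀ g : (κ → ℝ) → ℝ, Integrable g → Integrable fun y =>
        (ENNReal.ofReal (g y)).toReal • Complex.exp ((L y : ℂ) * I) := by
      intro g hg
      have h1 : Integrable fun y => ((max (g y) 0 : ℝ) : ℂ) * Complex.exp ((L y : ℂ) * I) :=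
        (hg.pos_part.ofReal (𝕜 := ℂ)).mul_bdd hLm
          (Filter.Eventually.of_forall fun y => (hexp L y).le)
      refine h1.congr (Filter.Eventually.of_forall fun y => ?_)
      simp [ENNReal.toReal_ofReal']
    rw [← integral_sub (hi f hf) (hi (fun y => -f y) hf.neg)]
    rw [← h fun j => L (Pi.single j 1)]
    refine integral_congr_ae (Filter.Eventually.of_forall fun y => ?_)
    simp only [← hL, ENNReal.toReal_ofReal']
    rw [← sub_smul, Complex.real_smul, mul_comm]
    congr 2
    rcases le_total (f y) 0 with h0 | h0
    · rw [max_eq_right h0, max_eq_left (by linarith)]; ring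
    · rw [max_eq_left h0, max_eq_right (by linarith)]; ring
  rw [withDensity_eq_iff hp hn hfp] at key
  filter_upwards [key] with y hy
  rcases lt_trichotomy (f y) 0 with h0 | h0 | h0
  · rw [ENNReal.ofReal_of_nonpos h0.le] at hy
    exact absurd hy.symm (by simpa using h0)
  · exact h0
  · rw [ENNReal.ofReal_of_nonpos (show -f y ≤ 0 by linarith)] at hy
    exact absurd hy (by simpa using h0)

/-- An integrable function with vanishing Fourier transform is zero. -/
theorem ae_eq_zero_of_fourier_eq_zero {k : (κ → ℝ) → ℂ} (hk : Integrable k)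
    (h : ∀ b : κ → ℝ, ∫ y, Complex.exp ((∑ j, b j * y j : ℝ) * I) * k y = 0) :
    k =ᵐ[volume] 0 := by
  have hm : ∀ b : κ → ℝ, AEStronglyMeasurable
      (fun y : κ → ℝ => Complex.exp ((∑ j, b j * y j : ℝ) * I)) volume := fun b => by
    apply Continuous.aestronglyMeasurable
    fun_prop
  have hi : ∀ (b : κ → ℝ) (g : (κ → ℝ) → ℂ), Integrable g →
      Integrable fun y => Complex.exp ((∑ j, b j * y j : ℝ) * I) * g y := fun b g hg =>
    hg.bdd_mul (hm b) (Filter.Eventually.of_forall fun y => (norm_exp_ofReal_mul_I _).le)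
  have hc : ∀ b : κ → ℝ,
      ∫ y, Complex.exp ((∑ j, b j * y j : ℝ) * I) * (starRingEnd ℂ) (k y) = 0 := by
    intro b
    have h1 := congrArg (starRingEnd ℂ) (h (-b))
    rw [← integral_conj, map_zero] at h1
    rw [← h1]
    refine integral_congr_ae (Filter.Eventually.of_forall fun y => ?_)
    simp only [map_mul, ← Complex.exp_conj, Pi.neg_apply, neg_mul, Finset.sum_neg_distrib,
      Complex.ofReal_neg, map_neg, Complex.conj_ofReal, Complex.conj_I, mul_neg, neg_neg]
  have hkc : Integrable fun y => (starRingEnd ℂ) (k y) := hk.congr'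
    (Complex.continuous_conj.comp_aestronglyMeasurable hk.aestronglyMeasurable)
    (Filter.Eventually.of_forall fun y => by simp)
  have hre : (fun y => (k y).re) =ᵐ[volume] 0 := by
    refine ae_eq_zero_of_fourier_eq_zero_real hk.re fun b => ?_
    have h2 : ∫ y, (Complex.exp ((∑ j, b j * y j : ℝ) * I) * k y
        + Complex.exp ((∑ j, b j * y j : ℝ) * I) * (starRingEnd ℂ) (k y)) / 2 = 0 := by
      rw [integral_div, integral_add (hi b k hk) (hi b _ hkc), h b, hc b]; simp
    rw [← h2]
    refine integral_congr_ae (Filter.Eventually.of_forall fun y => ?_)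
    simp only [← mul_add, Complex.add_conj]
    push_cast
    ring
  have him : (fun y => (k y).im) =ᵐ[volume] 0 := by
    refine ae_eq_zero_of_fourier_eq_zero_real hk.im fun b => ?_
    have h2 : ∫ y, (Complex.exp ((∑ j, b j * y j : ℝ) * I) * k y
        - Complex.exp ((∑ j, b j * y j : ℝ) * I) * (starRingEnd ℂ) (k y)) / (2 * I) = 0 := by
      rw [integral_div, integral_sub (hi b k hk) (hi b _ hkc), h b, hc b]; simp
    rw [← h2]
    refine integral_congr_ae (Filter.Eventually.of_forall fun y => ?_)
    simp only [← mul_sub, Complex.sub_conj]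
    push_cast
    field_simp
  filter_upwards [hre, him] with y h1 h2
  exact Complex.ext h1 h2

end FourierUniqueness

/-! ### Totality of the displaced Gaussian vectors. -/

section Gaussian

variable {ι κ : Type} [Fintype ι] [Fintype κ]

/-- The function `exp(-|y|²/2)`. -/
def gaussFun (y : κ → ℝ) : ℝ := Real.exp (-(1 / 2) * ∑ j, y j ^ 2)

theorem gaussFun_pos (y : κ → ℝ) : 0 < gaussFun y := Real.exp_pos _

theorem continuous_gaussFun : Continuous (gaussFun : (κ → ℝ) → ℝ) := by
  unfold gaussFun
  fun_prop

theorem integrable_exp_neg_mul_sum_sq {r : ℝ} (hr : 0 < r) :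
    Integrable fun y : κ → ℝ => Real.exp (-r * ∑ j, y j ^ 2) := by
  have h := (GaussianFourier.integrable_cexp_neg_mul_sum_add (b := (r : ℂ)) (by simpa using hr)
    (fun _ : κ => (0 : ℂ))).re
  refine h.congr (Filter.Eventually.of_forall fun y => ?_)
  have : (-(r : ℂ) * ∑ i, (y i : ℂ) ^ 2 + ∑ i, (0 : ℂ) * (y i : ℂ))
      = ((-r * ∑ j, y j ^ 2 : ℝ) : ℂ) := by push_cast; simp
  simp only [this, ← Complex.ofReal_exp]
  rfl

theorem memLp_gaussFun : MemLp (fun y : κ → ℝ => (gaussFun y : ℂ)) 2 volume := by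
  have hm : AEStronglyMeasurable (fun y : κ → ℝ => (gaussFun y : ℂ)) volume :=
    (Complex.continuous_ofReal.comp continuous_gaussFun).aestronglyMeasurable
  rw [memLp_two_iff_integrable_sq_norm hm]
  refine (integrable_exp_neg_mul_sum_sq one_pos).congr (Filter.Eventually.of_forall fun y => ?_)
  simp only [Complex.norm_real, Real.norm_eq_abs, sq_abs, gaussFun, ← Real.exp_nat_mul]
  congr 1
  push_cast
  ring

/-- The (unnormalized) Gaussian vector `exp(-|y|²/2)`. -/
def gaussVec (κ : Type) [Fintype κ] : ModeSpace κ := memLp_gaussFun.toLp _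

theorem gaussVec_coeFn : gaussVec κ =ᵐ[volume] fun y => (gaussFun y : ℂ) :=
  MemLp.coeFn_toLp memLp_gaussFun

/-- The phase space vector with positions `q.1` and momenta `q.2`. -/
def packModes (q : (κ → ℝ) × (κ → ℝ)) : κ × Fin 2 → ℝ := fun a => ![q.1 a.1, q.2 a.1] a.2

@[simp] theorem packModes_zero (q : (κ → ℝ) × (κ → ℝ)) (j : κ) : packModes q (j, 0) = q.1 j := rfl
@[simp] theorem packModes_one (q : (κ → ℝ) × (κ → ℝ)) (j : κ) : packModes q (j, 1) = q.2 j := rfl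

theorem continuous_packModes : Continuous (packModes : (κ → ℝ) × (κ → ℝ) → _) := by
  refine continuous_pi fun ⟨j, i⟩ => ?_
  fin_cases i
  · exact (continuous_apply j).comp continuous_fst
  · exact (continuous_apply j).comp continuous_snd

theorem packModes_neg (q : (κ → ℝ) × (κ → ℝ)) : packModes (-q) = -packModes q := by
  funext ⟨j, i⟩
  fin_cases i <;> rfl

/-- A vector orthogonal to all displaced Gaussians is zero. -/
theorem eq_zero_of_inner_displacement_gaussVec {ħ : ℝ} (hħ : ħ ≠ 0) {h : ModeSpace κ}
    (hh : ∀ u, ⟪displacement ħ u (gaussVec κ), h⟫_ℂ = 0) : h = 0 := by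
  have hk : Integrable fun y => (gaussFun y : ℂ) * h y := by
    refine (L2.integrable_inner (𝕜 := ℂ) (gaussVec κ) h).congr ?_
    filter_upwards [gaussVec_coeFn (κ := κ)] with y hy
    rw [hy, RCLike.inner_apply, Complex.conj_ofReal, mul_comm]
  have h0 := ae_eq_zero_of_fourier_eq_zero hk fun b => ?_
  · apply Lp.ext
    filter_upwards [h0, Lp.coeFn_zero ℂ 2 (volume : Measure (κ → ℝ))] with y hy hz
    rw [hz]
    exact (mul_eq_zero.1 hy).resolve_left (by exact_mod_cast (gaussFun_pos y).ne')
  -- A pure momentum shift by -ħb multiplies by exp(-i b·y); conjugation in the first slot of the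
  -- inner product turns this into the Fourier kernel exp(i b·y).
  · rw [← hh (packModes (0, fun j => -(ħ * b j))), L2.inner_def]
    refine integral_congr_ae ?_
    filter_upwards [displacement_coeFn ħ (packModes (0, fun j => -(ħ * b j))) (gaussVec κ),
      gaussVec_coeFn (κ := κ)] with y h1 h2
    rw [h1, RCLike.inner_apply, displacementFun]
    have : (y - fun j => packModes ((0 : κ → ℝ), fun j => -(ħ * b j)) (j, 0)) = y := by
      funext j; simp
    rw [this, h2, map_mul, displacementPhase, ← Complex.exp_conj]
    simp only [packModes_zero, packModes_one, map_mul, Complex.conj_I, Complex.conj_ofReal]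
    rw [mul_comm (h y), mul_assoc]
    congr 2
    have h3 : ħ⁻¹ * ∑ j, (-(ħ * b j) * y j - (0 : κ → ℝ) j * -(ħ * b j) / 2)
        = -∑ j, b j * y j := by
      rw [Finset.mul_sum, ← Finset.sum_neg_distrib]
      refine Finset.sum_congr rfl fun j _ => ?_
      simp only [Pi.zero_apply]
      field_simp
      ring
    rw [h3]
    push_cast
    ring

theorem gaussVec_ne_zero : gaussVec κ ≠ 0 := by
  intro h
  have h1 := gaussVec_coeFn (κ := κ)
  rw [h] at h1
  have h2 : ∀ᵐ _ : κ → ℝ, False := by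
    filter_upwards [h1, Lp.coeFn_zero ℂ 2 (volume : Measure (κ → ℝ))] with y h3 h4
    rw [h4] at h3
    exact (gaussFun_pos y).ne' (Complex.ofReal_eq_zero.1 h3.symm)
  have h3 := Filter.eventually_false_iff_eq_bot.1 h2
  rw [ae_eq_bot] at h3
  exact NeZero.ne (volume : Measure (κ → ℝ)) h3

theorem dense_span_displacement_gaussVec {ħ : ℝ} (hħ : ħ ≠ 0) :
    (Submodule.span ℂ (Set.range fun u => displacement ħ u (gaussVec κ))).topologicalClosure
      = ⊤ := by
  rw [Submodule.topologicalClosure_eq_top_iff, Submodule.eq_bot_iff]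
  intro h hh
  refine eq_zero_of_inner_displacement_gaussVec hħ fun u => ?_
  exact (Submodule.mem_orthogonal _ _).1 hh _ (Submodule.subset_span ⟨u, rfl⟩)

end Gaussian

/-! ### Gaussian averages of displacement operators. -/

section GaussianTransform

variable {ι κ : Type} [Fintype ι] [Fintype κ]

theorem inner_displacement_eq_integral (ħ : ℝ) (u : κ × Fin 2 → ℝ) (ζ ξ : ModeSpace κ) :
    ⟪ζ, displacement ħ u ξ⟫_ℂ = ∫ x, displacementFun ħ u ξ x * (starRingEnd ℂ) (ζ x) := by
  rw [L2.inner_def]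
  refine integral_congr_ae ?_
  filter_upwards [displacement_coeFn ħ u ξ] with x hx
  rw [hx, RCLike.inner_apply]

/-- The matrix element is a parametric integral of a jointly measurable function, so measurability
in u needs no strong continuity of the displacements. -/
theorem stronglyMeasurable_inner_displacement (ħ : ℝ) (ζ ξ : ModeSpace κ) :
    StronglyMeasurable fun u : κ × Fin 2 → ℝ => ⟪ζ, displacement ħ u ξ⟫_ℂ := by
  simp only [inner_displacement_eq_integral]
  apply StronglyMeasurable.integral_prod_right
    (f := fun u x => displacementFun ħ u ξ x * (starRingEnd ℂ) (ζ x))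
  refine StronglyMeasurable.mul (StronglyMeasurable.mul ?_ ?_) ?_
  · apply Continuous.stronglyMeasurable
    simp only [displacementPhase]
    fun_prop
  · refine (Lp.stronglyMeasurable ξ).comp_measurable (Continuous.measurable ?_)
    fun_prop
  · exact Complex.continuous_conj.comp_stronglyMeasurable
      ((Lp.stronglyMeasurable ζ).comp_measurable measurable_snd)

theorem norm_inner_displacement_le (ħ : ℝ) (u : κ × Fin 2 → ℝ) (ζ ξ : ModeSpace κ) :
    ‖⟪ζ, displacement ħ u ξ⟫_ℂ‖ ≤ ‖ζ‖ * ‖ξ‖ :=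
  (norm_inner_le_norm _ _).trans_eq (by rw [norm_displacement])

/-- The Gaussian weight `exp(-|a|²/4 - |b|²/(4ħ²))`. -/
def gaussWeight (ħ : ℝ) (q : (κ → ℝ) × (κ → ℝ)) : ℝ :=
  Real.exp (-(1 / 4) * ∑ j, q.1 j ^ 2) * Real.exp (-(1 / (4 * ħ ^ 2)) * ∑ j, q.2 j ^ 2)

theorem integrable_gaussWeight {ħ : ℝ} (hħ : 0 < ħ) :
    Integrable (gaussWeight ħ : (κ → ℝ) × (κ → ℝ) → ℝ) := by
  rw [Measure.volume_eq_prod]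
  exact (integrable_exp_neg_mul_sum_sq (by norm_num)).mul_prod
    (integrable_exp_neg_mul_sum_sq (by positivity))

theorem gaussWeight_neg (ħ : ℝ) (q : (κ → ℝ) × (κ → ℝ)) :
    gaussWeight ħ (-q) = gaussWeight ħ q := by
  simp [gaussWeight]

/-- The total mass of the momentum part of the Gaussian weight. -/
def gaussConst (ħ : ℝ) (κ : Type) [Fintype κ] : ℂ :=
  (Real.pi / ((1 / (4 * ħ ^ 2) : ℝ) : ℂ)) ^ (Fintype.card κ / 2 : ℂ)

theorem gaussConst_ne_zero {ħ : ℝ} (hħ : 0 < ħ) : gaussConst ħ κ ≠ 0 := by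
  have h : (Real.pi / ((1 / (4 * ħ ^ 2) : ℝ) : ℂ)) ≠ 0 := by
    refine div_ne_zero (by exact_mod_cast Real.pi_ne_zero) ?_
    exact_mod_cast (by positivity : (1 / (4 * ħ ^ 2) : ℝ) ≠ 0)
  rw [gaussConst, Complex.cpow_def_of_ne_zero h]
  exact Complex.exp_ne_zero _

/-- For fixed a the momentum integral is the Fourier transform of a Gaussian at the frequency (y -
a/2)/ħ. -/
theorem integral_gauss_mul_displacementPhase {ħ : ℝ} (hħ : 0 < ħ) (a y : κ → ℝ) :
    ∫ b : κ → ℝ, (Real.exp (-(1 / (4 * ħ ^ 2)) * ∑ j, b j ^ 2) : ℂ)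
        * displacementPhase ħ (packModes (a, b)) y
      = gaussConst ħ κ * Real.exp (-∑ j, (y j - a j / 2) ^ 2) := by
  have h := GaussianFourier.integral_cexp_neg_mul_sum_add (ι := κ)
    (b := ((1 / (4 * ħ ^ 2) : ℝ) : ℂ)) (by rw [Complex.ofReal_re]; positivity)
    (fun j => ((ħ⁻¹ * (y j - a j / 2) : ℝ) : ℂ) * I)
  have hr : (∑ j, (((ħ⁻¹ * (y j - a j / 2) : ℝ) : ℂ) * I) ^ 2) / (4 * ((1 / (4 * ħ ^ 2) : ℝ) : ℂ))
      = ((-∑ j, (y j - a j / 2) ^ 2 : ℝ) : ℂ) := by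
    have hħ' : (ħ : ℂ) ≠ 0 := by exact_mod_cast hħ.ne'
    rw [Finset.sum_div]
    push_cast
    rw [← Finset.sum_neg_distrib]
    refine Finset.sum_congr rfl fun j _ => ?_
    rw [mul_pow, I_sq]
    field_simp
  rw [hr, ← Complex.ofReal_exp] at h
  rw [gaussConst, ← h]
  refine integral_congr_ae (Filter.Eventually.of_forall fun b => ?_)
  simp only [displacementPhase, packModes_zero, packModes_one]
  rw [Complex.ofReal_exp, ← Complex.exp_add]
  congr 1
  have h2 : ((ħ⁻¹ * ∑ j, (b j * y j - a j * b j / 2) : ℝ) : ℂ) * I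
      = ∑ j, ((ħ⁻¹ * (y j - a j / 2) : ℝ) : ℂ) * I * (b j : ℂ) := by
    push_cast
    rw [Finset.mul_sum, Finset.sum_mul]
    refine Finset.sum_congr rfl fun j _ => ?_
    ring
  rw [h2]
  push_cast
  ring

/-- The identity a²/4 + (y - a/2)² = y²/2 + (y - a)²/2 separates y from y - a; it dictates the
position part of `gaussWeight`. -/
theorem gaussFun_mul_gaussFun_sub (a y : κ → ℝ) :
    Real.exp (-(1 / 4) * ∑ j, a j ^ 2) * Real.exp (-∑ j, (y j - a j / 2) ^ 2)
      = gaussFun y * gaussFun (y - a) := by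
  rw [gaussFun, gaussFun, ← Real.exp_add, ← Real.exp_add]
  congr 1
  simp only [Finset.mul_sum, ← Finset.sum_neg_distrib, ← Finset.sum_add_distrib, Pi.sub_apply]
  refine Finset.sum_congr rfl fun j _ => ?_
  ring

theorem integrable_gaussFun_mul (g : ModeSpace κ) :
    Integrable fun y => (gaussFun y : ℂ) * g y := by
  refine (L2.integrable_inner (𝕜 := ℂ) (gaussVec κ) g).congr ?_
  filter_upwards [gaussVec_coeFn (κ := κ)] with y hy
  rw [hy, RCLike.inner_apply, Complex.conj_ofReal, mul_comm]

theorem integral_gaussFun_mul (g : ModeSpace κ) :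
    ∫ y, (gaussFun y : ℂ) * g y = ⟪gaussVec κ, g⟫_ℂ := by
  rw [L2.inner_def]
  refine integral_congr_ae ?_
  filter_upwards [gaussVec_coeFn (κ := κ)] with y hy
  rw [hy, RCLike.inner_apply, Complex.conj_ofReal, mul_comm]

theorem integrable_gaussWeight_mul_inner {ħ : ℝ} (hħ : 0 < ħ) (ζ ξ : ModeSpace ι)
    {u : (κ → ℝ) × (κ → ℝ) → ι × Fin 2 → ℝ} (hu : Continuous u) :
    Integrable fun q : (κ → ℝ) × (κ → ℝ) =>
      (gaussWeight ħ q : ℂ) * ⟪ζ, displacement ħ (u q) ξ⟫_ℂ := by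
  refine (integrable_gaussWeight hħ).ofReal.mul_bdd (c := ‖ζ‖ * ‖ξ‖) ?_
    (Filter.Eventually.of_forall fun q => norm_inner_displacement_le ħ _ ζ ξ)
  exact ((stronglyMeasurable_inner_displacement ħ ζ ξ).comp_measurable
    hu.measurable).aestronglyMeasurable

theorem integral_momentum_gauss_mul_inner {ħ : ℝ} (hħ : 0 < ħ) (g g' : ModeSpace κ) (a : κ → ℝ) :
    ∫ b : κ → ℝ, (Real.exp (-(1 / (4 * ħ ^ 2)) * ∑ j, b j ^ 2) : ℂ)
        * ⟪g, displacement ħ (packModes (a, b)) g'⟫_ℂ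
      = gaussConst ħ κ * ∫ y, (Real.exp (-∑ j, (y j - a j / 2) ^ 2) : ℂ)
        * (g' (y - a) * (starRingEnd ℂ) (g y)) := by
  have hg : Integrable fun y => g' (y - a) * (starRingEnd ℂ) (g y) := by
    refine (L2.integrable_inner (𝕜 := ℂ) g (displacement ħ (packModes (a, 0)) g')).congr ?_
    filter_upwards [displacement_coeFn ħ (packModes (a, 0)) g'] with y hy
    rw [hy, RCLike.inner_apply, displacementFun]
    have : displacementPhase ħ (packModes (a, 0)) y = 1 := by simp [displacementPhase]
    rw [this, one_mul]
    rfl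
  have hF : Integrable (Function.uncurry fun (b y : κ → ℝ) =>
      displacementPhase ħ (packModes (a, b)) y * ((Real.exp (-(1 / (4 * ħ ^ 2)) * ∑ j, b j ^ 2) : ℂ)
        * (g' (y - a) * (starRingEnd ℂ) (g y)))) (volume.prod volume) := by
    refine Integrable.bdd_mul (c := 1) ((integrable_exp_neg_mul_sum_sq
      (by positivity : 0 < 1 / (4 * ħ ^ 2))).ofReal.mul_prod hg) ?_
      (Filter.Eventually.of_forall fun q => (norm_displacementPhase _ _ _).le)
    apply Continuous.aestronglyMeasurable
    simp only [displacementPhase, packModes_zero, packModes_one]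
    fun_prop
  have h1 : ∀ b : κ → ℝ, (Real.exp (-(1 / (4 * ħ ^ 2)) * ∑ j, b j ^ 2) : ℂ)
        * ⟪g, displacement ħ (packModes (a, b)) g'⟫_ℂ
      = ∫ y, displacementPhase ħ (packModes (a, b)) y
        * ((Real.exp (-(1 / (4 * ħ ^ 2)) * ∑ j, b j ^ 2) : ℂ)
        * (g' (y - a) * (starRingEnd ℂ) (g y))) := by
    intro b
    rw [inner_displacement_eq_integral, ← integral_const_mul]
    refine integral_congr_ae (Filter.Eventually.of_forall fun y => ?_)
    simp only [displacementFun]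
    rw [← mul_assoc, ← mul_assoc, ← mul_assoc, ← mul_assoc, mul_comm (displacementPhase _ _ _)]
    rfl
  simp only [h1]
  rw [integral_integral_swap hF, ← integral_const_mul]
  refine integral_congr_ae (Filter.Eventually.of_forall fun y => ?_)
  dsimp only
  rw [← mul_assoc, ← integral_gauss_mul_displacementPhase hħ a y, ← integral_mul_const]
  refine integral_congr_ae (Filter.Eventually.of_forall fun b => ?_)
  dsimp only
  ring

/-- The Gaussian integral of displacement operators is the projection on the Gaussian vector. -/
theorem integral_gaussWeight_mul_inner {ħ : ℝ} (hħ : 0 < ħ) (g g' : ModeSpace κ) :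
    ∫ q, (gaussWeight ħ q : ℂ) * ⟪g, displacement ħ (packModes q) g'⟫_ℂ
      = gaussConst ħ κ * (⟪g, gaussVec κ⟫_ℂ * ⟪gaussVec κ, g'⟫_ℂ) := by
  have hi := integrable_gaussWeight_mul_inner hħ g g' (continuous_packModes (κ := κ))
  rw [Measure.volume_eq_prod] at hi ⊢
  rw [integral_prod _ hi]
  have h1 : ∀ a : κ → ℝ, ∫ b : κ → ℝ, (gaussWeight ħ (a, b) : ℂ)
        * ⟪g, displacement ħ (packModes (a, b)) g'⟫_ℂ
      = gaussConst ħ κ * ∫ y, ((gaussFun y : ℂ) * (starRingEnd ℂ) (g y))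
        * ((gaussFun (-(a - y)) : ℂ) * g' (-(a - y))) := by
    intro a
    simp only [gaussWeight, Complex.ofReal_mul, mul_assoc]
    rw [integral_const_mul, integral_momentum_gauss_mul_inner hħ, mul_left_comm,
      ← integral_const_mul]
    congr 1
    refine integral_congr_ae (Filter.Eventually.of_forall fun y => ?_)
    have h2 := congrArg Complex.ofReal (gaussFun_mul_gaussFun_sub a y)
    simp only [Complex.ofReal_mul] at h2
    dsimp only
    rw [← mul_assoc, h2, neg_sub]
    ring
  simp only [h1]
  rw [integral_const_mul]
  congr 1
  have hk : Integrable fun y => (gaussFun y : ℂ) * (starRingEnd ℂ) (g y) := by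
    refine (integrable_gaussFun_mul g).congr' (Continuous.aestronglyMeasurable
      (Complex.continuous_ofReal.comp continuous_gaussFun) |>.mul
      (Complex.continuous_conj.comp_aestronglyMeasurable (Lp.aestronglyMeasurable g))) ?_
    exact Filter.Eventually.of_forall fun y => by simp
  have hl : Integrable fun y => (gaussFun (-y) : ℂ) * g' (-y) := (integrable_gaussFun_mul g').comp_neg
  -- The remaining double integral is the total integral of a convolution, hence a product of two
  -- integrals.
  have hconv := integral_convolution (ContinuousLinearMap.mul ℂ ℂ) hk hl
  simp only [convolution, ContinuousLinearMap.mul_apply'] at hconv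
  rw [hconv, integral_neg_eq_self (fun y => (gaussFun y : ℂ) * g' y), integral_gaussFun_mul]
  congr 1
  rw [← inner_conj_symm, ← integral_gaussFun_mul, ← integral_conj]
  simp only [map_mul, Complex.conj_ofReal]

end GaussianTransform

/-! ### Gaussian averages with spectator modes. -/

section TensorTransform

variable {ι κ : Type} [Fintype ι] [Fintype κ]

theorem gaussVec_sum : gaussVec (ι ⊕ κ) = prodVec (gaussVec ι) (gaussVec κ) := by
  have hmp := volume_measurePreserving_sumPiEquivProdPi (fun _ : ι ⊕ κ => ℝ)
  have hl : Measure.QuasiMeasurePreserving (fun z : ι ⊕ κ → ℝ => fun i => z (Sum.inl i))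
      volume volume := Measure.quasiMeasurePreserving_fst.comp hmp.quasiMeasurePreserving
  have hr : Measure.QuasiMeasurePreserving (fun z : ι ⊕ κ → ℝ => fun k => z (Sum.inr k))
      volume volume := Measure.quasiMeasurePreserving_snd.comp hmp.quasiMeasurePreserving
  apply Lp.ext
  filter_upwards [gaussVec_coeFn (κ := ι ⊕ κ), prodVec_coeFn (gaussVec ι) (gaussVec κ),
    hl.ae (gaussVec_coeFn (κ := ι)), hr.ae (gaussVec_coeFn (κ := κ))] with z h1 h2 h3 h4
  rw [h1, h2, prodFun, h3, h4, ← Complex.ofReal_mul, gaussFun, gaussFun, gaussFun, ← Real.exp_add,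
    Fintype.sum_sum_type, mul_add]

theorem exists_joinModes_eq (u : (ι ⊕ κ) × Fin 2 → ℝ) :
    ∃ (v : ι × Fin 2 → ℝ) (w : κ × Fin 2 → ℝ), joinModes v w = u := by
  refine ⟨fun a => u (Sum.inl a.1, a.2), fun a => u (Sum.inr a.1, a.2), ?_⟩
  funext ⟨a, i⟩
  cases a <;> rfl

/-- The product vectors are total. -/
theorem dense_span_prodVec :
    Dense (Submodule.span ℂ (Set.range fun q : ModeSpace ι × ModeSpace κ =>
      prodVec q.1 q.2) : Set (ModeSpace (ι ⊕ κ))) := by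
  rw [Submodule.dense_iff_topologicalClosure_eq_top, eq_top_iff,
    ← dense_span_displacement_gaussVec (κ := ι ⊕ κ) one_ne_zero]
  refine Submodule.topologicalClosure_mono (Submodule.span_mono ?_)
  rintro _ ⟨u, rfl⟩
  obtain ⟨v, w, rfl⟩ := exists_joinModes_eq u
  refine ⟨(displacement 1 v (gaussVec ι), displacement 1 w (gaussVec κ)), ?_⟩
  exact (by rw [gaussVec_sum, displacement_prodVec] : prodVec _ _ = displacement 1 (joinModes v w)
    (gaussVec (ι ⊕ κ)))

theorem continuous_joinModes_packModes : Continuous fun q : (κ → ℝ) × (κ → ℝ) =>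
    joinModes (0 : ι × Fin 2 → ℝ) (packModes q) := by
  refine continuous_pi fun ⟨a, i⟩ => ?_
  cases a with
  | inl j => exact continuous_const
  | inr k => exact (continuous_apply (k, i)).comp continuous_packModes

/-- The Gaussian average of `⟪ζ, (1 ⊗ D_u) ξ⟫` as a functional of `ξ`. -/
def weylAverage {ħ : ℝ} (hħ : 0 < ħ) (ζ : ModeSpace (ι ⊕ κ)) : ModeSpace (ι ⊕ κ) →L[ℂ] ℂ :=
  LinearMap.mkContinuous
    { toFun := fun ξ => ∫ q : (κ → ℝ) × (κ → ℝ), (gaussWeight ħ q : ℂ)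
        * ⟪ζ, displacement ħ (joinModes 0 (packModes q)) ξ⟫_ℂ
      map_add' := fun ξ ξ' => by
        rw [← integral_add (integrable_gaussWeight_mul_inner hħ ζ ξ continuous_joinModes_packModes)
          (integrable_gaussWeight_mul_inner hħ ζ ξ' continuous_joinModes_packModes)]
        simp only [map_add, inner_add_right, mul_add]
      map_smul' := fun c ξ => by
        rw [RingHom.id_apply, smul_eq_mul, ← integral_const_mul]
        simp only [map_smul, inner_smul_right, mul_left_comm] }
    ((∫ q : (κ → ℝ) × (κ → ℝ), gaussWeight ħ q) * ‖ζ‖)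
    fun ξ => by
      rw [mul_assoc, ← integral_mul_const]
      refine norm_integral_le_of_norm_le ((integrable_gaussWeight hħ).mul_const _)
        (Filter.Eventually.of_forall fun q => ?_)
      have h0 : 0 ≤ gaussWeight ħ q := by unfold gaussWeight; positivity
      rw [norm_mul, Complex.norm_real, Real.norm_of_nonneg h0]
      exact mul_le_mul_of_nonneg_left (norm_inner_displacement_le _ _ _ _) h0

theorem weylAverage_apply {ħ : ℝ} (hħ : 0 < ħ) (ζ ξ : ModeSpace (ι ⊕ κ)) :
    weylAverage hħ ζ ξ = ∫ q : (κ → ℝ) × (κ → ℝ), (gaussWeight ħ q : ℂ)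
        * ⟪ζ, displacement ħ (joinModes 0 (packModes q)) ξ⟫_ℂ := rfl

/-- The weight is even and the adjoint of a displacement is the opposite displacement. -/
theorem weylAverage_conj {ħ : ℝ} (hħ : 0 < ħ) (ζ ξ : ModeSpace (ι ⊕ κ)) :
    (starRingEnd ℂ) (weylAverage hħ ζ ξ) = weylAverage hħ ξ ζ := by
  have : (volume : Measure ((κ → ℝ) × (κ → ℝ))).IsNegInvariant := by
    rw [Measure.volume_eq_prod]
    exact ⟨((Measure.measurePreserving_neg volume).prod
      (Measure.measurePreserving_neg volume)).map_eq⟩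
  rw [weylAverage_apply, weylAverage_apply, ← integral_conj,
    ← integral_neg_eq_self (μ := (volume : Measure ((κ → ℝ) × (κ → ℝ))))]
  refine integral_congr_ae (Filter.Eventually.of_forall fun q => ?_)
  dsimp only
  have h0 : joinModes (0 : ι × Fin 2 → ℝ) (packModes (-q)) = -joinModes 0 (packModes q) := by
    rw [joinModes_neg, packModes_neg, neg_zero]
  rw [map_mul, Complex.conj_ofReal, inner_conj_symm, gaussWeight_neg, h0,
    inner_displacement_left, neg_neg]

/-- On product vectors ξ the spectator factor comes out of the integral and
`integral_gaussWeight_mul_inner` applies; totality of the product vectors extends this to all ξ. -/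
theorem weylAverage_prodVec {ħ : ℝ} (hħ : 0 < ħ) (f : ModeSpace ι) (g : ModeSpace κ)
    (ξ : ModeSpace (ι ⊕ κ)) :
    weylAverage hħ (prodVec f g) ξ = gaussConst ħ κ *
      ⟪ContinuousLinearMap.adjoint (tensorRight (gaussVec κ)) (prodVec f g),
        ContinuousLinearMap.adjoint (tensorRight (gaussVec κ)) ξ⟫_ℂ := by
  suffices h : weylAverage hħ (prodVec f g) = gaussConst ħ κ •
      (innerSL ℂ (ContinuousLinearMap.adjoint (tensorRight (gaussVec κ)) (prodVec f g)) ∘L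
        ContinuousLinearMap.adjoint (tensorRight (gaussVec κ))) by
    rw [h]; rfl
  refine ContinuousLinearMap.ext_on dense_span_prodVec ?_
  rintro _ ⟨⟨f', g'⟩, rfl⟩
  simp only [smul_apply, ContinuousLinearMap.comp_apply, innerSL_apply_apply,
    adjoint_tensorRight_prodVec, inner_smul_left, inner_smul_right, smul_eq_mul, weylAverage_apply,
    displacement_prodVec, inner_prodVec, displacement_zero]
  rw [inner_conj_symm]
  have h := integral_gaussWeight_mul_inner hħ g g'
  calc _ = ⟪f, f'⟫_ℂ * ∫ q, (gaussWeight ħ q : ℂ) * ⟪g, displacement ħ (packModes q) g'⟫_ℂ := by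
        rw [← integral_const_mul]
        refine integral_congr_ae (Filter.Eventually.of_forall fun q => ?_)
        exact mul_left_comm _ _ _
    _ = _ := by rw [h]; ring

/-- Hermitian symmetry puts a product vector into the first slot, where `weylAverage_prodVec`
applies, and totality is used a second time. -/
theorem weylAverage_eq {ħ : ℝ} (hħ : 0 < ħ) (ζ ξ : ModeSpace (ι ⊕ κ)) :
    weylAverage hħ ζ ξ = gaussConst ħ κ *
      ⟪ContinuousLinearMap.adjoint (tensorRight (gaussVec κ)) ζ,
        ContinuousLinearMap.adjoint (tensorRight (gaussVec κ)) ξ⟫_ℂ := by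
  suffices h : weylAverage hħ ζ = gaussConst ħ κ •
      (innerSL ℂ (ContinuousLinearMap.adjoint (tensorRight (gaussVec κ)) ζ) ∘L
        ContinuousLinearMap.adjoint (tensorRight (gaussVec κ))) by
    rw [h]; rfl
  refine ContinuousLinearMap.ext_on dense_span_prodVec ?_
  rintro _ ⟨⟨f', g'⟩, rfl⟩
  have hreal : (starRingEnd ℂ) (gaussConst ħ κ) = gaussConst ħ κ := by
    -- The constant is defined as a complex power. Its reality is read off from Hermitian symmetry
    -- at a diagonal matrix element that does not vanish, with no spectator modes.
    have h1 := weylAverage_conj (ι := PEmpty) hħ (prodVec (gaussVec PEmpty) (gaussVec κ))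
      (prodVec (gaussVec PEmpty) (gaussVec κ))
    rw [weylAverage_prodVec, map_mul, inner_conj_symm] at h1
    refine mul_right_cancel₀ ?_ h1
    rw [adjoint_tensorRight_prodVec, inner_self_ne_zero]
    exact smul_ne_zero (inner_self_ne_zero.2 gaussVec_ne_zero) gaussVec_ne_zero
  simp only [smul_apply, ContinuousLinearMap.comp_apply, innerSL_apply_apply]
  rw [← weylAverage_conj, weylAverage_prodVec, map_mul, inner_conj_symm, hreal, smul_eq_mul]

end TensorTransform

/-! ### Operators acting componentwise on ℓ²(β; H). -/

section Amplification

variable {H H' : Type} [NormedAddCommGroup H] [InnerProductSpace ℂ H]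
  [NormedAddCommGroup H'] [InnerProductSpace ℂ H'] {β : Type}

/-- The operator acting as `X` on each summand of `ℓ²(β; H)`. -/
def amplify (β : Type) (X : H →L[ℂ] H') : lp (fun _ : β => H) 2 →L[ℂ] lp (fun _ : β => H') 2 :=
  lp.mapCLM 2 (fun _ => X) (norm_nonneg X) fun _ => le_rfl

@[simp]
theorem amplify_apply (X : H →L[ℂ] H') (ξ : lp (fun _ : β => H) 2) (i : β) :
    amplify β X ξ i = X (ξ i) := rfl

theorem norm_amplify_le (X : H →L[ℂ] H') : ‖amplify β X‖ ≤ ‖X‖ :=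
  lp.norm_mapCLM_le 2 _ _ _

theorem summable_norm_mul_norm (ζ ξ : lp (fun _ : β => H) 2) :
    Summable fun i => ‖ζ i‖ * ‖ξ i‖ := by
  have h : ∀ η : lp (fun _ : β => H) 2, Summable fun i => ‖η i‖ ^ 2 := fun η => by
    have := (lp.memℓp η).summable (by norm_num)
    simpa using this
  refine Summable.of_nonneg_of_le (fun _ => by positivity) (fun i => ?_) ((h ζ).add (h ξ))
  nlinarith [sq_nonneg (‖ζ i‖ - ‖ξ i‖), sq_nonneg (‖ζ i‖), sq_nonneg (‖ξ i‖)]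

end Amplification

/-! ### Rank-one operators in the closed span of a displacement orbit. -/

section Closure

variable {ι κ : Type} [Fintype ι] [Fintype κ] {β : Type}

/-- Sums `weylAverage_eq` over the components; sum and integral may be exchanged because the norms
are dominated by the integrable weight times ‖ζᵢ‖‖ξᵢ‖. -/
theorem integral_gaussWeight_mul_inner_amplify [Countable β] {ħ : ℝ} (hħ : 0 < ħ)
    (ζ ξ : lp (fun _ : β => ModeSpace (ι ⊕ κ)) 2) :
    ∫ q : (κ → ℝ) × (κ → ℝ), (gaussWeight ħ q : ℂ)
        * ⟪ζ, amplify β (displacement ħ (joinModes 0 (packModes q))) ξ⟫_ℂ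
      = gaussConst ħ κ * ⟪ζ, amplify β (tensorRight (gaussVec κ) ∘L
        ContinuousLinearMap.adjoint (tensorRight (gaussVec κ))) ξ⟫_ℂ := by
  have hs : Summable fun i => ∫ q : (κ → ℝ) × (κ → ℝ), ‖(gaussWeight ħ q : ℂ)
      * ⟪ζ i, displacement ħ (joinModes 0 (packModes q)) (ξ i)⟫_ℂ‖ := by
    refine Summable.of_nonneg_of_le (fun i => integral_nonneg fun _ => norm_nonneg _) (fun i => ?_)
      ((summable_norm_mul_norm ζ ξ).mul_left (∫ q : (κ → ℝ) × (κ → ℝ), gaussWeight ħ q))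
    rw [← integral_mul_const]
    refine integral_mono
      (integrable_gaussWeight_mul_inner hħ (ζ i) (ξ i) continuous_joinModes_packModes).norm
      ((integrable_gaussWeight hħ).mul_const _) fun q => ?_
    have h0 : 0 ≤ gaussWeight ħ q := by unfold gaussWeight; positivity
    dsimp only
    rw [norm_mul, Complex.norm_real, Real.norm_of_nonneg h0]
    exact mul_le_mul_of_nonneg_left (norm_inner_displacement_le _ _ _ _) h0
  have h1 := hasSum_integral_of_summable_integral_norm
    (fun i => integrable_gaussWeight_mul_inner hħ (ζ i) (ξ i) continuous_joinModes_packModes) hs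
  have h2 : ∀ q : (κ → ℝ) × (κ → ℝ), ∑' i, (gaussWeight ħ q : ℂ)
      * ⟪ζ i, displacement ħ (joinModes 0 (packModes q)) (ξ i)⟫_ℂ = (gaussWeight ħ q : ℂ)
        * ⟪ζ, amplify β (displacement ħ (joinModes 0 (packModes q))) ξ⟫_ℂ := fun q => by
    rw [tsum_mul_left, lp.inner_eq_tsum]
    simp only [amplify_apply]
  simp only [h2] at h1
  have h3 := (lp.hasSum_inner ζ (amplify β (tensorRight (gaussVec κ) ∘L
    ContinuousLinearMap.adjoint (tensorRight (gaussVec κ))) ξ)).mul_left (gaussConst ħ κ)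
  have h4 : (fun i => ∫ q : (κ → ℝ) × (κ → ℝ), (gaussWeight ħ q : ℂ)
      * ⟪ζ i, displacement ħ (joinModes 0 (packModes q)) (ξ i)⟫_ℂ)
      = fun i => gaussConst ħ κ * ⟪ζ i, amplify β (tensorRight (gaussVec κ) ∘L
        ContinuousLinearMap.adjoint (tensorRight (gaussVec κ))) ξ i⟫_ℂ := by
    funext i
    rw [← weylAverage_apply hħ, weylAverage_eq, amplify_apply, ContinuousLinearMap.comp_apply,
      ContinuousLinearMap.adjoint_inner_left]
  rw [h4] at h1
  exact h1.unique h3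

theorem norm_tensorRight_le (g : ModeSpace κ) :
    ‖(tensorRight g : ModeSpace ι →L[ℂ] ModeSpace (ι ⊕ κ))‖ ≤ ‖g‖ :=
  LinearMap.mkContinuous_norm_le _ (norm_nonneg _) _

theorem tensorRight_add (g g' : ModeSpace κ) :
    (tensorRight (g + g') : ModeSpace ι →L[ℂ] ModeSpace (ι ⊕ κ)) = tensorRight g + tensorRight g' :=
  ContinuousLinearMap.ext fun f => prodVec_add_right f g g'

theorem tensorRight_smul (c : ℂ) (g : ModeSpace κ) :
    (tensorRight (c • g) : ModeSpace ι →L[ℂ] ModeSpace (ι ⊕ κ)) = c • tensorRight g :=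
  ContinuousLinearMap.ext fun f => prodVec_smul_right c f g

theorem tensorRight_displacement (ħ : ℝ) (w : κ × Fin 2 → ℝ) (g : ModeSpace κ) :
    (tensorRight (displacement ħ w g) : ModeSpace ι →L[ℂ] ModeSpace (ι ⊕ κ))
      = displacement ħ (joinModes 0 w) ∘L tensorRight g := by
  ext1 f
  rw [ContinuousLinearMap.comp_apply, tensorRight_apply, tensorRight_apply, displacement_prodVec,
    displacement_zero]

/-- The vector `(1 ⊗ |φ⟩⟨h|) ξ`, with `φ` the Gaussian vector, as a function of `h`. -/
def rankOneOrbit (ξ : lp (fun _ : β => ModeSpace (ι ⊕ κ)) 2) :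
    ModeSpace κ →SL[starRingEnd ℂ] lp (fun _ : β => ModeSpace (ι ⊕ κ)) 2 :=
  LinearMap.mkContinuous
    { toFun := fun h => amplify β (tensorRight (gaussVec κ) ∘L
        ContinuousLinearMap.adjoint (tensorRight h)) ξ
      map_add' := fun h h' => by
        ext1; funext i
        simp [tensorRight_add]
      map_smul' := fun c h => by
        ext1; funext i
        rw [tensorRight_smul, LinearIsometryEquiv.map_smulₛₗ, lp.coeFn_smul, Pi.smul_apply,
          amplify_apply, amplify_apply, ContinuousLinearMap.comp_apply, smul_apply, map_smul]
        rfl }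
    (‖(tensorRight (gaussVec κ) : ModeSpace ι →L[ℂ] ModeSpace (ι ⊕ κ))‖ * ‖ξ‖)
    fun h => by
      refine ((amplify β (tensorRight (gaussVec κ) ∘L
        ContinuousLinearMap.adjoint (tensorRight h))).le_opNorm ξ).trans ?_
      rw [mul_right_comm]
      refine mul_le_mul_of_nonneg_right ((norm_amplify_le _).trans
        ((ContinuousLinearMap.opNorm_comp_le _ _).trans ?_)) (norm_nonneg _)
      refine mul_le_mul_of_nonneg_left ?_ (norm_nonneg _)
      rw [LinearIsometryEquiv.norm_map]
      exact norm_tensorRight_le h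

theorem rankOneOrbit_apply (ξ : lp (fun _ : β => ModeSpace (ι ⊕ κ)) 2) (h : ModeSpace κ) (i : β) :
    rankOneOrbit ξ h i = tensorRight (gaussVec κ)
      (ContinuousLinearMap.adjoint (tensorRight h) (ξ i)) := rfl

/-- The closed span of the orbit of `ξ` under the displacements of the modes `κ` contains the
vectors `(1 ⊗ |φ⟩⟨h|) ξ`. -/
theorem rankOneOrbit_mem_closure [Countable β] {ħ : ℝ} (hħ : 0 < ħ)
    (ξ : lp (fun _ : β => ModeSpace (ι ⊕ κ)) 2) (h : ModeSpace κ) :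
    rankOneOrbit ξ h ∈ (Submodule.span ℂ (Set.range fun u : κ × Fin 2 → ℝ =>
      amplify β (displacement ħ (joinModes 0 u)) ξ)).topologicalClosure := by
  set M := (Submodule.span ℂ (Set.range fun u : κ × Fin 2 → ℝ =>
      amplify β (displacement ħ (joinModes (0 : ι × Fin 2 → ℝ) u)) ξ)) with hM
  have hcl : IsClosed ((M.topologicalClosure.comap (rankOneOrbit ξ).toLinearMap :
      Submodule ℂ (ModeSpace κ)) : Set (ModeSpace κ)) :=
    M.isClosed_topologicalClosure.preimage (rankOneOrbit ξ).continuous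
  -- The orbit map is continuous and conjugate-linear in h, so the admissible h form a closed
  -- subspace; it suffices to treat the total family of displaced Gaussian vectors.
  suffices hle : Submodule.span ℂ (Set.range fun u => displacement ħ u (gaussVec κ))
      ≤ M.topologicalClosure.comap (rankOneOrbit ξ).toLinearMap by
    have h2 := Submodule.topologicalClosure_minimal _ hle hcl
    rw [dense_span_displacement_gaussVec hħ.ne'] at h2
    exact h2 Submodule.mem_top
  rw [Submodule.span_le]
  rintro _ ⟨w, rfl⟩
  change rankOneOrbit ξ (displacement ħ w (gaussVec κ)) ∈ M.topologicalClosure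
  -- For ζ orthogonal to the orbit, every integrand of the Gaussian average is a multiple of an
  -- inner product of ζ with an orbit vector, so the average vanishes.
  rw [← Submodule.orthogonal_orthogonal_eq_closure, Submodule.mem_orthogonal]
  intro ζ hζ
  have h1 := integral_gaussWeight_mul_inner_amplify (κ := κ) hħ ζ
    (amplify β (displacement ħ (-joinModes 0 w)) ξ)
  have h2 : ∀ q : (κ → ℝ) × (κ → ℝ),
      ⟪ζ, amplify β (displacement ħ (joinModes 0 (packModes q)))
        (amplify β (displacement ħ (-joinModes 0 w)) ξ)⟫_ℂ = 0 := by
    intro q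
    have h3 : ∃ c : ℂ, amplify β (displacement ħ (joinModes (0 : ι × Fin 2 → ℝ) (packModes q)))
        (amplify β (displacement ħ (-joinModes 0 w)) ξ)
        = c • amplify β (displacement ħ (joinModes 0 (packModes q - w))) ξ := by
      refine ⟨Complex.exp (((-(ħ⁻¹ * sympl (joinModes (0 : ι × Fin 2 → ℝ) (packModes q))
        (-joinModes 0 w) / 2) : ℝ) : ℂ) * I), ?_⟩
      · ext1; funext i
        rw [lp.coeFn_smul, Pi.smul_apply, amplify_apply, amplify_apply, amplify_apply,
          displacement_comp, joinModes_neg, joinModes_add, neg_zero, zero_add, ← sub_eq_add_neg]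
    obtain ⟨c, h3⟩ := h3
    rw [h3]
    exact Submodule.inner_left_of_mem_orthogonal
      (M.smul_mem c (Submodule.subset_span ⟨_, rfl⟩)) hζ
  simp only [h2, mul_zero, integral_zero] at h1
  have h4 := (mul_eq_zero.1 h1.symm).resolve_left (gaussConst_ne_zero hħ)
  -- This is |φ⟩⟨D_w φ| = |φ⟩⟨φ| D_{-w} on the modes κ.
  have h5 : rankOneOrbit ξ (displacement ħ w (gaussVec κ)) = amplify β (tensorRight (gaussVec κ) ∘L
        ContinuousLinearMap.adjoint (tensorRight (gaussVec κ)))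
        (amplify β (displacement ħ (-joinModes 0 w)) ξ) := by
    ext1; funext i
    rw [rankOneOrbit_apply, tensorRight_displacement, ContinuousLinearMap.adjoint_comp,
      adjoint_displacement]
    rfl
  rw [h5]
  exact h4

end Closure

/-! ### Exponentials of positive semidefinite kernels. -/

section Kernels

variable {m a : Type} [Fintype m] [Fintype a]

/-- The Schur product theorem, iterated from the all-ones matrix. -/
theorem _root_.Matrix.PosSemidef.map_pow {N : Matrix m m ℂ} (hN : N.PosSemidef) (k : ℕ) :
    (N.map (· ^ k)).PosSemidef := by
  induction k with
  | zero =>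
    have h := Matrix.posSemidef_vecMulVec_self_star (fun _ : m => (1 : ℂ))
    convert h using 1
    ext i j
    simp [Matrix.vecMulVec_apply]
  | succ k ih =>
    have h : N.map (· ^ (k + 1)) = (N.map (· ^ k)).hadamard N := by
      ext i j
      simp [pow_succ]
    rw [h]
    exact ih.hadamard hN

/-- The entrywise exponential of a positive semidefinite matrix is positive semidefinite. -/
theorem _root_.Matrix.PosSemidef.re_sum_exp_nonneg {N : Matrix m m ℂ} (hN : N.PosSemidef)
    (c : m → ℂ) :
    0 ≤ (∑ p, ∑ q, (starRingEnd ℂ) (c p) * c q * Complex.exp (N p q)).re := by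
  have h1 : HasSum (fun k : ℕ => ∑ p, ∑ q, (starRingEnd ℂ) (c p) * c q
      * ((k.factorial : ℂ)⁻¹ * N p q ^ k))
      (∑ p, ∑ q, (starRingEnd ℂ) (c p) * c q * Complex.exp (N p q)) := by
    refine hasSum_sum fun p _ => hasSum_sum fun q _ => HasSum.mul_left _ ?_
    rw [Complex.exp_eq_exp_ℂ]
    simpa only [smul_eq_mul] using NormedSpace.exp_series_hasSum_exp' (𝕂 := ℂ) (N p q)
  refine (Complex.hasSum_re h1).nonneg fun k => ?_
  have h2 := (hN.map_pow k).dotProduct_mulVec_nonneg c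
  have h3 : ∑ p, ∑ q, (starRingEnd ℂ) (c p) * c q * ((k.factorial : ℂ)⁻¹ * N p q ^ k)
      = ((k.factorial : ℝ)⁻¹ : ℝ) * (star c ⬝ᵥ (N.map (· ^ k)) *ᵥ c) := by
    simp only [dotProduct, Matrix.mulVec, Matrix.map_apply, Finset.mul_sum, Pi.star_apply]
    refine Finset.sum_congr rfl fun p _ => Finset.sum_congr rfl fun q _ => ?_
    push_cast
    rw [starRingEnd_apply]
    ring
  rw [h3, Complex.re_ofReal_mul]
  exact mul_nonneg (by positivity) (Complex.le_def.1 h2).1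

/-- Gram matrices of a positive semidefinite form. -/
theorem _root_.Matrix.PosSemidef.gram {M : Matrix a a ℂ} (hM : M.PosSemidef) (x : m → a → ℂ) :
    (Matrix.of fun p q => star (x p) ⬝ᵥ M *ᵥ x q).PosSemidef := by
  have h := hM.conjTranspose_mul_mul_same (Matrix.of fun (i : a) (p : m) => x p i)
  convert h using 1
  ext p q
  simp only [Matrix.of_apply, Matrix.mul_assoc]
  rw [Matrix.mul_apply]
  simp only [dotProduct, Matrix.mulVec, Matrix.mul_apply, Matrix.conjTranspose_apply,
    Matrix.of_apply, Pi.star_apply]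

/-- Infinitesimal form of positivity of exponential kernels. -/
theorem re_sum_nonneg_of_exp {α : m → m → ℂ} {c : m → ℂ} (hc : ∑ p, c p = 0)
    (h : ∀ s : ℝ, 0 < s → 0 ≤ (∑ p, ∑ q, (starRingEnd ℂ) (c p) * c q
      * Complex.exp (s * α p q)).re) :
    0 ≤ (∑ p, ∑ q, (starRingEnd ℂ) (c p) * c q * α p q).re := by
  set F : ℝ → ℂ := fun s => ∑ p, ∑ q, (starRingEnd ℂ) (c p) * c q * Complex.exp (s * α p q)
    with hF
  have hd : HasDerivAt F (∑ p, ∑ q, (starRingEnd ℂ) (c p) * c q * α p q) 0 := by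
    refine HasDerivAt.fun_sum fun p _ => HasDerivAt.fun_sum fun q _ => HasDerivAt.const_mul _ ?_
    have h1 : HasDerivAt (fun s : ℝ => (s : ℂ) * α p q) (α p q) 0 := by
      simpa using (Complex.ofRealCLM.hasDerivAt (x := (0 : ℝ))).mul_const (α p q)
    simpa using h1.cexp
  -- The coefficients sum to zero, so F vanishes at 0; as its real part is nonnegative to the right,
  -- so is the derivative there.
  have h0 : F 0 = 0 := by
    simp only [hF, Complex.ofReal_zero, zero_mul, Complex.exp_zero, mul_one, ← Finset.mul_sum, hc,
      mul_zero, Finset.sum_const_zero]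
  have hr : HasDerivAt (fun s => (F s).re)
      (∑ p, ∑ q, (starRingEnd ℂ) (c p) * c q * α p q).re 0 :=
    Complex.reCLM.hasFDerivAt.comp_hasDerivAt (0 : ℝ) hd
  have ht := hr.tendsto_slope_zero_right
  refine ge_of_tendsto ht ?_
  filter_upwards [self_mem_nhdsWithin] with s hs
  rw [zero_add, h0, Complex.zero_re, sub_zero, smul_eq_mul]
  exact mul_nonneg (inv_nonneg.2 (le_of_lt hs)) (h s hs)

end Kernels

/-! ### The symplectic form in coordinates. -/

section Symplectic

variable {ι κ : Type} [Fintype ι] [DecidableEq ι] [Fintype κ] [DecidableEq κ]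

theorem Omega_mulVec_zero (y : ι × Fin 2 → ℝ) (j : ι) : (Omega ι *ᵥ y) (j, 0) = y (j, 1) := by
  simp [Omega, Omega1, Matrix.mulVec, dotProduct, Fintype.sum_prod_type, Matrix.one_apply]

theorem Omega_mulVec_one (y : ι × Fin 2 → ℝ) (j : ι) : (Omega ι *ᵥ y) (j, 1) = -y (j, 0) := by
  simp [Omega, Omega1, Matrix.mulVec, dotProduct, Fintype.sum_prod_type, Matrix.one_apply]

theorem dotProduct_Omega_mulVec (u w : ι × Fin 2 → ℝ) : u ⬝ᵥ (Omega ι *ᵥ w) = sympl u w := by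
  simp only [dotProduct, Fintype.sum_prod_type, Fin.sum_univ_two, Omega_mulVec_zero,
    Omega_mulVec_one, sympl]
  exact Finset.sum_congr rfl fun j _ => by ring

theorem sympl_Omega_mulVec (u w : ι × Fin 2 → ℝ) :
    sympl (Omega ι *ᵥ u) (Omega ι *ᵥ w) = sympl u w := by
  simp only [sympl, Omega_mulVec_zero, Omega_mulVec_one]
  exact Finset.sum_congr rfl fun j _ => by ring

theorem sympl_smul_smul (r t : ℝ) (u w : ι × Fin 2 → ℝ) :
    sympl (r • u) (t • w) = r * t * sympl u w := by
  simp only [sympl, Pi.smul_apply, smul_eq_mul, Finset.mul_sum]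
  exact Finset.sum_congr rfl fun j _ => by ring

theorem Omega_mulVec_joinModes (v : ι × Fin 2 → ℝ) (u : κ × Fin 2 → ℝ) :
    Omega (ι ⊕ κ) *ᵥ joinModes v u = joinModes (Omega ι *ᵥ v) (Omega κ *ᵥ u) := by
  funext ⟨b, i⟩
  fin_cases i
  · cases b
    · exact (Omega_mulVec_zero _ _).trans (Omega_mulVec_zero v _).symm
    · exact (Omega_mulVec_zero _ _).trans (Omega_mulVec_zero u _).symm
  · cases b
    · exact (Omega_mulVec_one _ _).trans (Omega_mulVec_one v _).symm
    · exact (Omega_mulVec_one _ _).trans (Omega_mulVec_one u _).symm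

theorem Omega_mulVec_neg_Omega_mulVec (y : ι × Fin 2 → ℝ) :
    Omega ι *ᵥ (-(Omega ι *ᵥ y)) = y := by
  funext ⟨j, i⟩
  fin_cases i
  · exact (Omega_mulVec_zero _ _).trans (by rw [Pi.neg_apply, Omega_mulVec_one, neg_neg]; rfl)
  · exact (Omega_mulVec_one _ _).trans (by rw [Pi.neg_apply, Omega_mulVec_zero, neg_neg]; rfl)

end Symplectic

/-! ### Quadratic forms of the constraint matrices. -/

section Forms

variable {a : Type} [Fintype a]

/-- A real vector as a complex vector. -/
def toC (x : a → ℝ) : a → ℂ := fun i => (x i : ℂ)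

theorem star_toC (x : a → ℝ) : star (toC x) = toC x := by
  funext i
  simp [toC]

theorem toC_dotProduct_map_mulVec (A : Matrix a a ℝ) (x y : a → ℝ) :
    toC x ⬝ᵥ (A.map Complex.ofReal *ᵥ toC y) = ((x ⬝ᵥ (A *ᵥ y) : ℝ) : ℂ) := by
  simp [dotProduct, Matrix.mulVec, toC]

theorem toC_dotProduct_lastBlock_mulVec {n : ℕ} (W : Matrix (Fin n × Fin 2) (Fin n × Fin 2) ℂ)
    (v v' : Unit × Fin 2 → ℝ) (u u' : Fin n × Fin 2 → ℝ) :
    toC (joinModes v u) ⬝ᵥ (lastBlock n W *ᵥ toC (joinModes v' u')) = toC u ⬝ᵥ (W *ᵥ toC u') := by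
  simp [dotProduct, Matrix.mulVec, toC, joinModes, lastBlock, Fintype.sum_prod_type]

theorem toC_dotProduct_firstBlock_mulVec {n : ℕ} (Z : Matrix (Fin 2) (Fin 2) ℂ)
    (v v' : Fin 2 → ℝ) (u u' : Fin n × Fin 2 → ℝ) :
    toC (joinModes (fun b : Unit × Fin 2 => v b.2) u)
      ⬝ᵥ (firstBlock n Z *ᵥ toC (joinModes (fun b : Unit × Fin 2 => v' b.2) u'))
      = toC v ⬝ᵥ (Z *ᵥ toC v') := by
  simp [dotProduct, Matrix.mulVec, toC, joinModes, firstBlock, Fintype.sum_prod_type]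

theorem Omega_unit_mulVec (v : Fin 2 → ℝ) :
    (Omega Unit *ᵥ fun b : Unit × Fin 2 => v b.2) = fun b => (Omega1 *ᵥ v) b.2 := by
  funext ⟨b, i⟩
  fin_cases i
  · refine (Omega_mulVec_zero _ _).trans ?_
    simp [Omega1, Matrix.mulVec, dotProduct]
  · refine (Omega_mulVec_one _ _).trans ?_
    simp [Omega1, Matrix.mulVec, dotProduct]

/-- The form of the second constraint on real vectors. -/
theorem toC_dotProduct_constraint_mulVec {n : ℕ} (ħ : ℝ)
    (S : Matrix ((Unit ⊕ Fin n) × Fin 2) ((Unit ⊕ Fin n) × Fin 2) ℝ)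
    (Z : Matrix (Fin 2) (Fin 2) ℂ) (v : Fin 2 → ℝ) (r t : ℝ) (u w : Fin n × Fin 2 → ℝ) :
    toC (Omega (Unit ⊕ Fin n) *ᵥ joinModes (r • fun b : Unit × Fin 2 => v b.2) u) ⬝ᵥ
      ((S.map Complex.ofReal + (1 : ℂ) • lastBlock n ((I * ħ / 2) • (Omega (Fin n)).map Complex.ofReal)
        - firstBlock n Z) *ᵥ
          toC (Omega (Unit ⊕ Fin n) *ᵥ joinModes (t • fun b : Unit × Fin 2 => v b.2) w))
      = (((Omega (Unit ⊕ Fin n) *ᵥ joinModes (r • fun b : Unit × Fin 2 => v b.2) u) ⬝ᵥ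
          (S *ᵥ (Omega (Unit ⊕ Fin n) *ᵥ joinModes (t • fun b : Unit × Fin 2 => v b.2) w)) : ℝ) : ℂ)
        + I * ħ / 2 * sympl u w - r * t * (toC (Omega1 *ᵥ v) ⬝ᵥ (Z *ᵥ toC (Omega1 *ᵥ v))) := by
  rw [one_smul, Matrix.sub_mulVec, Matrix.add_mulVec, dotProduct_sub, dotProduct_add,
    toC_dotProduct_map_mulVec]
  simp only [Omega_mulVec_joinModes, Matrix.mulVec_smul, Omega_unit_mulVec]
  rw [toC_dotProduct_lastBlock_mulVec, Matrix.smul_mulVec, dotProduct_smul,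
    toC_dotProduct_map_mulVec, dotProduct_Omega_mulVec, sympl_Omega_mulVec, smul_eq_mul]
  have hs : ∀ r : ℝ, (r • fun b : Unit × Fin 2 => (Omega1 *ᵥ v) b.2)
      = fun b => (r • (Omega1 *ᵥ v)) b.2 := fun _ => rfl
  have hc : ∀ r : ℝ, toC (r • (Omega1 *ᵥ v)) = (r : ℂ) • toC (Omega1 *ᵥ v) := fun r => by
    funext i; simp [toC]
  rw [hs, hs, toC_dotProduct_firstBlock_mulVec, hc, hc, Matrix.mulVec_smul, smul_dotProduct,
    dotProduct_smul, smul_eq_mul, smul_eq_mul, mul_assoc]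

theorem im_toC_dotProduct_mulVec {Z : Matrix a a ℂ} (hZ : Z.IsHermitian) (x : a → ℝ) :
    (toC x ⬝ᵥ (Z *ᵥ toC x)).im = 0 := by
  have h := hZ.im_star_dotProduct_mulVec_self (toC x)
  rwa [star_toC] at h

theorem toC_dotProduct_transpose_mulVec (Z : Matrix a a ℂ) (x : a → ℝ) :
    toC x ⬝ᵥ (Zᵀ *ᵥ toC x) = toC x ⬝ᵥ (Z *ᵥ toC x) := by
  rw [Matrix.mulVec_transpose, dotProduct_comm, Matrix.dotProduct_mulVec]

theorem transpose_lastBlock (n : ℕ) (W : Matrix (Fin n × Fin 2) (Fin n × Fin 2) ℂ) :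
    (lastBlock n W)ᵀ = lastBlock n Wᵀ := by
  ext ⟨b, i⟩ ⟨c, j⟩
  cases b <;> cases c <;> rfl

theorem transpose_firstBlock (n : ℕ) (Z : Matrix (Fin 2) (Fin 2) ℂ) :
    (firstBlock n Z)ᵀ = firstBlock n Zᵀ := by
  ext ⟨b, i⟩ ⟨c, j⟩
  cases b <;> cases c <;> rfl

theorem transpose_Omega1 : Omega1ᵀ = -Omega1 := by
  ext i j
  fin_cases i <;> fin_cases j <;> simp [Omega1]

theorem transpose_Omega (ι : Type) [DecidableEq ι] : (Omega ι)ᵀ = -Omega ι := by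
  ext ⟨b, i⟩ ⟨c, j⟩
  have h := congrFun (congrFun transpose_Omega1 i) j
  rw [Matrix.transpose_apply, Matrix.neg_apply] at h
  simp [Omega, Matrix.one_apply, h, eq_comm]

theorem transpose_smul_map_Omega (ħ : ℝ) (ι : Type) [DecidableEq ι] :
    ((I * ħ / 2) • (Omega ι).map Complex.ofReal)ᵀ = -((I * ħ / 2) • (Omega ι).map Complex.ofReal) := by
  rw [Matrix.transpose_smul, ← Matrix.transpose_map, transpose_Omega]
  ext i j
  simp

end Forms

/-! ### Transposition symmetry, compactness and attainment of the program. -/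

section Program

variable {n : ℕ} {ħ : ℝ} {S : Matrix ((Unit ⊕ Fin n) × Fin 2) ((Unit ⊕ Fin n) × Fin 2) ℝ}

/-- The second constraint for one sign implies that for the sign `+1` with `Z` or `Zᵀ`. -/
theorem exists_posSemidef_of_mem_sdpFeasible (hS : S.IsSymm) {s : ℝ}
    (hs : s ∈ ({1, -1} : Set ℝ)) {Z : Matrix (Fin 2) (Fin 2) ℂ} (hZ : Z ∈ sdpFeasible ħ n s S)
    (x : Fin 2 → ℝ) :
    ∃ Z' : Matrix (Fin 2) (Fin 2) ℂ, toC x ⬝ᵥ (Z' *ᵥ toC x) = toC x ⬝ᵥ (Z *ᵥ toC x) ∧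
      (S.map Complex.ofReal + (1 : ℂ) • lastBlock n ((I * ħ / 2) • (Omega (Fin n)).map Complex.ofReal)
        - firstBlock n Z').PosSemidef := by
  rcases hs with rfl | hs
  · exact ⟨Z, rfl, by simpa using hZ.2.2⟩
  · rw [Set.mem_singleton_iff] at hs
    subst hs
    refine ⟨Zᵀ, toC_dotProduct_transpose_mulVec Z x, ?_⟩
    -- Transposition keeps positivity, fixes the symmetric S and flips the sign of the antisymmetric
    -- Ωₙ; Z and Zᵀ agree as quadratic forms on real vectors.
    have h := hZ.2.2.transpose
    rw [Matrix.transpose_sub, Matrix.transpose_add, Matrix.transpose_smul, transpose_lastBlock,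
      transpose_firstBlock, transpose_smul_map_Omega, ← Matrix.transpose_map, hS.eq] at h
    have h2 : ((-1 : ℝ) : ℂ) • lastBlock n (-((I * ħ / 2) • (Omega (Fin n)).map Complex.ofReal))
        = (1 : ℂ) • lastBlock n ((I * ħ / 2) • (Omega (Fin n)).map Complex.ofReal) := by
      ext ⟨b, i⟩ ⟨c, j⟩
      cases b <;> cases c <;> simp [lastBlock]
    rwa [h2] at h

theorem sdpObjective_eq (ħ : ℝ) (v : Fin 2 → ℝ) (Z : Matrix (Fin 2) (Fin 2) ℂ) :
    sdpObjective ħ v Z = 1 / (Real.pi * ħ ^ 2)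
      * (toC (Omega1 *ᵥ v) ⬝ᵥ (Z *ᵥ toC (Omega1 *ᵥ v))).re := rfl

theorem isClosed_posSemidef {a : Type} [Fintype a] :
    IsClosed {M : Matrix a a ℂ | M.PosSemidef} := by
  simp only [Matrix.posSemidef_iff_dotProduct_mulVec, Set.ofPred_and, Set.ofPred_forall,
    Matrix.IsHermitian]
  refine IsClosed.inter (isClosed_eq (by fun_prop) (by fun_prop)) (isClosed_iInter fun x => ?_)
  exact isClosed_le continuous_const (by fun_prop)

/-- The diagonal of Ω₁ vanishes, so the first constraint makes the diagonal of Z nonnegative and the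
second bounds it by that of S. The determinant of Z - i(ħ/2)Ω₁ then controls the off-diagonal
entries. -/
theorem isCompact_sdpFeasible (s : ℝ) : IsCompact (sdpFeasible ħ n s S) := by
  -- The summand |ħ| absorbs the off-diagonal entry iħ/2 of the shift in the first constraint.
  set R : ℝ := ∑ i : Fin 2, |S (Sum.inl (), i) (Sum.inl (), i)| + |ħ| with hR
  have hK : IsCompact (Set.univ.pi fun _ : Fin 2 => Set.univ.pi fun _ : Fin 2 =>
      Metric.closedBall (0 : ℂ) R) :=
    isCompact_univ_pi fun _ => isCompact_univ_pi fun _ => isCompact_closedBall _ _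
  refine hK.of_isClosed_subset ?_ ?_
  · have h1 : IsClosed {Z : Matrix (Fin 2) (Fin 2) ℂ | Z.IsHermitian} :=
      isClosed_eq (by fun_prop) (by fun_prop)
    have hf : Continuous fun Z : Matrix (Fin 2) (Fin 2) ℂ => firstBlock n Z := by
      refine continuous_matrix fun ⟨b, i⟩ ⟨c, j⟩ => ?_
      cases b <;> cases c <;> simp only [firstBlock, Matrix.of_apply] <;> fun_prop
    have h2 : IsClosed {Z : Matrix (Fin 2) (Fin 2) ℂ |
        (Z - (I * ħ / 2) • Omega1.map Complex.ofReal).PosSemidef} :=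
      isClosed_posSemidef.preimage (by fun_prop)
    have h3 := isClosed_posSemidef.preimage (f := fun Z : Matrix (Fin 2) (Fin 2) ℂ =>
      S.map Complex.ofReal
      + (s : ℂ) • lastBlock n ((I * ħ / 2) • (Omega (Fin n)).map Complex.ofReal)
      - firstBlock n Z) (continuous_const.sub hf)
    exact h1.inter (h2.inter h3)
  · rintro (Z : Matrix (Fin 2) (Fin 2) ℂ) ⟨hZ, hZ1, hZ2⟩
    have hd : ∀ i, 0 ≤ (Z i i).re ∧ (Z i i).im = 0 ∧
        (Z i i).re ≤ |S (Sum.inl (), i) (Sum.inl (), i)| := by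
      intro i
      have h1 := hZ1.diag_nonneg (i := i)
      have h2 := hZ2.diag_nonneg (i := (Sum.inl (), i))
      have h0 : Omega1 i i = 0 := by fin_cases i <;> simp [Omega1]
      simp only [Matrix.sub_apply, Matrix.add_apply, Matrix.smul_apply, Matrix.map_apply, lastBlock,
        firstBlock, Matrix.of_apply, h0, smul_eq_mul, mul_zero, add_zero, Complex.ofReal_zero,
        sub_zero, Omega] at h1 h2
      have h1' := Complex.le_def.1 h1
      have h2' := (Complex.le_def.1 h2).1
      simp only [Complex.sub_re, Complex.ofReal_re, Complex.zero_re] at h2'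
      exact ⟨h1'.1, h1'.2.symm, by linarith [le_abs_self (S (Sum.inl (), i) (Sum.inl (), i))]⟩
    have hR0 := hd 0
    have hR1 := hd 1
    have hsum : R = |S (Sum.inl (), 0) (Sum.inl (), 0)| + |S (Sum.inl (), 1) (Sum.inl (), 1)| + |ħ| := by
      rw [hR, Fin.sum_univ_two]
    have hdn : ∀ i, ‖Z i i‖ ≤ R := by
      intro i
      obtain ⟨h1, h2, h3⟩ := hd i
      have h4 : Z i i = ((Z i i).re : ℂ) := Complex.ext rfl (by simpa using h2)
      rw [h4, Complex.norm_real, Real.norm_of_nonneg h1]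
      have := abs_nonneg (S (Sum.inl (), 0) (Sum.inl (), 0))
      have := abs_nonneg (S (Sum.inl (), 1) (Sum.inl (), 1))
      have := abs_nonneg ħ
      fin_cases i <;> simp only [Fin.zero_eta, Fin.mk_one] at * <;> linarith
    have hoff : ‖Z 0 1‖ ≤ R := by
      set N := Z - (I * ħ / 2) • Omega1.map Complex.ofReal with hN
      have hdet := hZ1.det_nonneg
      rw [Matrix.det_fin_two] at hdet
      have h10 : N 1 0 = (starRingEnd ℂ) (N 0 1) := (hZ1.1.apply 1 0).symm
      have h00 : N 0 0 = ((Z 0 0).re : ℂ) :=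
        Complex.ext (by simp [hN, Omega1]) (by simp [hN, Omega1, hR0.2.1])
      have h11 : N 1 1 = ((Z 1 1).re : ℂ) :=
        Complex.ext (by simp [hN, Omega1]) (by simp [hN, Omega1, hR1.2.1])
      rw [h10, h00, h11, Complex.mul_conj, Complex.normSq_eq_norm_sq] at hdet
      have h5 : ‖N 0 1‖ ^ 2 ≤ (Z 0 0).re * (Z 1 1).re := by
        have := (Complex.le_def.1 hdet).1
        rw [← Complex.ofReal_mul, ← Complex.ofReal_sub, Complex.zero_re, Complex.ofReal_re] at this
        linarith
      have h6 : ‖N 0 1‖ ≤ (Z 0 0).re + (Z 1 1).re := by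
        nlinarith [norm_nonneg (N 0 1), hR0.1, hR1.1]
      have h7 : Z 0 1 = N 0 1 + I * ħ / 2 := by simp [hN, Omega1]
      rw [h7]
      have h8 : ‖(I * ħ / 2 : ℂ)‖ ≤ |ħ| := by
        rw [norm_div, norm_mul, Complex.norm_I, Complex.norm_real, one_mul, Real.norm_eq_abs]
        have := abs_nonneg ħ
        norm_num
      linarith [norm_add_le (N 0 1) (I * ħ / 2 : ℂ), hR0.2.2, hR1.2.2]
    have hoff' : ‖Z 1 0‖ ≤ R := by
      rw [← hZ.apply 1 0, norm_star]
      exact hoff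
    intro i _ j _
    rw [mem_closedBall_zero_iff]
    fin_cases i <;> fin_cases j
    · exact hdn 0
    · exact hoff
    · exact hoff'
    · exact hdn 1

theorem continuous_sdpObjective (v : Fin 2 → ℝ) : Continuous (sdpObjective ħ v) := by
  unfold sdpObjective
  fun_prop

/-- The uncertainty relation makes the program with the sign `-1` solvable. -/
theorem exists_isMax_sdpObjective (hS : S.IsSymm)
    (hU : (S.map Complex.ofReal + (I * ħ / 2) • (Omega (Unit ⊕ Fin n)).map Complex.ofReal).PosSemidef)
    (v : Fin 2 → ℝ) :
    ∃ Z₀ ∈ sdpFeasible ħ n (-1) S, ∀ Z ∈ sdpFeasible ħ n (-1) S,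
      sdpObjective ħ v Z ≤ sdpObjective ħ v Z₀ := by
  -- This witness makes the first constraint an equality and turns the second into the transposed
  -- uncertainty relation S - i(ħ/2)Ω ≥ 0.
  have hne : ((I * ħ / 2) • Omega1.map Complex.ofReal) ∈ sdpFeasible ħ n (-1) S := by
    refine ⟨?_, ?_, ?_⟩
    · ext i j
      fin_cases i <;> fin_cases j <;> simp [Omega1, neg_div]
    · rw [sub_self]
      exact Matrix.PosSemidef.zero
    · have h := hU.transpose
      rw [Matrix.transpose_add, transpose_smul_map_Omega, ← Matrix.transpose_map, hS.eq] at h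
      have h2 : ((-1 : ℝ) : ℂ) • lastBlock n ((I * ħ / 2) • (Omega (Fin n)).map Complex.ofReal)
          - firstBlock n ((I * ħ / 2) • Omega1.map Complex.ofReal)
          = -((I * ħ / 2) • (Omega (Unit ⊕ Fin n)).map Complex.ofReal) := by
        ext ⟨b, i⟩ ⟨c, j⟩
        cases b <;> cases c <;> simp [lastBlock, firstBlock, Omega, Matrix.one_apply]
      rwa [add_sub_assoc, h2]
  obtain ⟨Z₀, h0, h1⟩ := (isCompact_sdpFeasible (S := S) (ħ := ħ) (-1)).exists_isMaxOn ⟨_, hne⟩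
    (continuous_sdpObjective (ħ := ħ) v).continuousOn
  exact ⟨Z₀, h0, fun Z hZ => h1 hZ⟩

end Program

/-! ### The Gaussian kernel and the uncertainty relation. -/

section CharacteristicFunction

variable {ι : Type} [Fintype ι] [DecidableEq ι] {β : Type}

theorem sympl_neg_left (u w : ι × Fin 2 → ℝ) : sympl (-u) w = -sympl u w := by
  simp only [sympl, Pi.neg_apply, ← Finset.sum_neg_distrib]
  exact Finset.sum_congr rfl fun j _ => by ring

theorem inner_amplify_displacement (ħ : ℝ) (ξ : lp (fun _ : β => ModeSpace ι) 2)
    (y y' : ι × Fin 2 → ℝ) :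
    ⟪amplify β (displacement ħ y) ξ, amplify β (displacement ħ y') ξ⟫_ℂ
      = Complex.exp (((ħ⁻¹ * sympl y y' / 2 : ℝ) : ℂ) * I)
        * ⟪ξ, amplify β (displacement ħ (y' - y)) ξ⟫_ℂ := by
  rw [lp.inner_eq_tsum, lp.inner_eq_tsum, ← tsum_mul_left]
  refine tsum_congr fun i => ?_
  rw [amplify_apply, amplify_apply, amplify_apply, inner_displacement_left, displacement_comp,
    inner_smul_right, sympl_neg_left, neg_add_eq_sub]
  congr 4
  ring

/-- The characteristic function of the Gaussian state with mean `μ` and covariance `S`. -/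
def gaussianChar (ħ : ℝ) (μ : ι × Fin 2 → ℝ) (S : Matrix (ι × Fin 2) (ι × Fin 2) ℝ)
    (v : ι × Fin 2 → ℝ) : ℂ :=
  Complex.exp (((-(1 / (2 * ħ ^ 2)) * ((Omega ι *ᵥ v) ⬝ᵥ (S *ᵥ (Omega ι *ᵥ v))) : ℝ) : ℂ)
      + ((ħ⁻¹ * ((Omega ι *ᵥ v) ⬝ᵥ μ) : ℝ) : ℂ) * I)

theorem dotProduct_mulVec_sub_sub {a : Type} [Fintype a] {S : Matrix a a ℝ} (hS : S.IsSymm)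
    (x x' : a → ℝ) :
    (x' - x) ⬝ᵥ (S *ᵥ (x' - x)) = x ⬝ᵥ (S *ᵥ x) + x' ⬝ᵥ (S *ᵥ x') - 2 * (x ⬝ᵥ (S *ᵥ x')) := by
  have h : x' ⬝ᵥ (S *ᵥ x) = x ⬝ᵥ (S *ᵥ x') := by
    rw [Matrix.dotProduct_mulVec, ← Matrix.mulVec_transpose, hS.eq, dotProduct_comm]
  rw [Matrix.mulVec_sub, sub_dotProduct, dotProduct_sub, dotProduct_sub, h]
  ring

/-- Expanding the quadratic form at y' - y leaves terms in y or y' alone, which form a rank-one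
factor, and a cross term. The Weyl phase joins the cross term as the imaginary part of S + i(ħ/2)Ω.
-/
theorem exp_sympl_mul_gaussianChar {ħ : ℝ} (hħ : ħ ≠ 0) (μ : ι × Fin 2 → ℝ)
    {S : Matrix (ι × Fin 2) (ι × Fin 2) ℝ} (hS : S.IsSymm) (y y' : ι × Fin 2 → ℝ) :
    Complex.exp (((ħ⁻¹ * sympl y y' / 2 : ℝ) : ℂ) * I) * gaussianChar ħ μ S (y' - y)
      = (starRingEnd ℂ) (gaussianChar ħ μ S y) * gaussianChar ħ μ S y'
        * Complex.exp (((1 / ħ ^ 2 : ℝ) : ℂ) *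
          ((((Omega ι *ᵥ y) ⬝ᵥ (S *ᵥ (Omega ι *ᵥ y')) : ℝ) : ℂ) + I * ħ / 2 * sympl y y')) := by
  simp only [gaussianChar]
  rw [← Complex.exp_conj, ← Complex.exp_add, ← Complex.exp_add, ← Complex.exp_add]
  congr 1
  rw [Matrix.mulVec_sub, dotProduct_mulVec_sub_sub hS, sub_dotProduct]
  simp only [map_add, map_mul, Complex.conj_ofReal, Complex.conj_I]
  have hc : (ħ : ℂ) ≠ 0 := by exact_mod_cast hħ
  push_cast
  field_simp
  ring

theorem re_sum_inner_nonneg {H : Type} [NormedAddCommGroup H] [InnerProductSpace ℂ H]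
    {m : Type} [Fintype m] (x : m → H) (c : m → ℂ) :
    0 ≤ (∑ p, ∑ q, (starRingEnd ℂ) (c p) * c q * ⟪x p, x q⟫_ℂ).re := by
  have h : ∑ p, ∑ q, (starRingEnd ℂ) (c p) * c q * ⟪x p, x q⟫_ℂ
      = ⟪∑ p, c p • x p, ∑ q, c q • x q⟫_ℂ := by
    simp only [sum_inner, inner_sum, inner_smul_left, inner_smul_right, Finset.mul_sum]
    rw [Finset.sum_comm]
    refine (Finset.sum_congr rfl fun p _ => Finset.sum_congr rfl fun q _ => by ring)
  rw [h]
  exact inner_self_nonneg (𝕜 := ℂ)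

variable {ħ : ℝ} {μ : ι × Fin 2 → ℝ} {S : Matrix (ι × Fin 2) (ι × Fin 2) ℝ}
  {ξ : lp (fun _ : β => ModeSpace ι) 2}

/-- The covariance matrix of a Gaussian state satisfies the uncertainty relation. -/
theorem uncertainty_relation (hħ : 0 < ħ) (hS : S.IsSymm)
    (hξ : ∀ y, ⟪ξ, amplify β (displacement ħ y) ξ⟫_ℂ = gaussianChar ħ μ S y) :
    (S.map Complex.ofReal + (I * ħ / 2) • (Omega ι).map Complex.ofReal).PosSemidef := by
  set M := S.map Complex.ofReal + (I * ħ / 2) • (Omega ι).map Complex.ofReal with hM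
  have hherm : M.IsHermitian := by
    have h1 : ((I * ħ / 2) • (Omega ι).map Complex.ofReal)ᴴ
        = (I * ħ / 2) • (Omega ι).map Complex.ofReal := by
      rw [Matrix.conjTranspose, transpose_smul_map_Omega]
      ext i j
      simp [neg_div, map_ofNat]
    have h2 : (S.map Complex.ofReal)ᴴ = S.map Complex.ofReal := by
      rw [Matrix.conjTranspose, ← Matrix.transpose_map, hS.eq]
      ext i j
      simp
    rw [Matrix.IsHermitian, hM, Matrix.conjTranspose_add, h1, h2]
  refine Matrix.PosSemidef.of_dotProduct_mulVec_nonneg hherm fun z => ?_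
  -- The points Re z, Im z, 0 with weights 1, i, -(1 + i) represent z = Re z + i Im z; the third
  -- point only makes the weights sum to zero.
  set x : Fin 3 → ι × Fin 2 → ℝ := ![fun i => (z i).re, fun i => (z i).im, 0] with hx
  set Y : Fin 3 → ι × Fin 2 → ℝ := fun k => -(Omega ι *ᵥ x k) with hY
  set c : Fin 3 → ℂ := ![1, I, -(1 + I)] with hc
  have hYx : ∀ k, Omega ι *ᵥ Y k = x k := fun k => Omega_mulVec_neg_Omega_mulVec _
  have hB : ∀ p q, ((x p ⬝ᵥ (S *ᵥ x q) : ℝ) : ℂ) + I * ħ / 2 * sympl (Y p) (Y q)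
      = toC (x p) ⬝ᵥ (M *ᵥ toC (x q)) := by
    intro p q
    rw [hM, Matrix.add_mulVec, dotProduct_add, toC_dotProduct_map_mulVec, Matrix.smul_mulVec,
      dotProduct_smul, toC_dotProduct_map_mulVec, dotProduct_Omega_mulVec, ← hYx p, ← hYx q,
      sympl_Omega_mulVec, smul_eq_mul]
  -- The subtracted terms depend on p or q alone, so they drop out of the final sum because the
  -- weights add up to zero.
  set α : Fin 3 → Fin 3 → ℂ := fun p q => ((1 / ħ ^ 2 : ℝ) : ℂ) * (toC (x p) ⬝ᵥ (M *ᵥ toC (x q))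
    - ((x p ⬝ᵥ (S *ᵥ x p) / 2 : ℝ) : ℂ) - ((x q ⬝ᵥ (S *ᵥ x q) / 2 : ℝ) : ℂ)) with hα
  have hcomm : ∀ a b c d e f g : ℂ, a * b * (c * d) * (e * f * g)
      = a * c * (b * d * (e * f * g)) := by
    intros
    ring
  have key := re_sum_nonneg_of_exp (α := α) (c := c) (by simp [hc, Fin.sum_univ_three])
    fun s hs => by
      -- Scaling the displacements by √s scales the quadratic exponent by s; the phases from the
      -- mean are linear in √s and are cancelled by the coefficients.
      have h1 := re_sum_inner_nonneg (fun k => amplify β (displacement ħ (Real.sqrt s • Y k)) ξ)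
        (fun k => c k * Complex.exp (-(((ħ⁻¹ * (Real.sqrt s * (x k ⬝ᵥ μ)) : ℝ) : ℂ) * I)))
      refine h1.trans_eq (congrArg Complex.re
        (Finset.sum_congr rfl fun p _ => Finset.sum_congr rfl fun q _ => Eq.symm ?_))
      rw [inner_amplify_displacement, hξ, exp_sympl_mul_gaussianChar hħ.ne' μ hS, gaussianChar,
        gaussianChar, ← Complex.exp_conj, map_mul, ← Complex.exp_conj, hcomm]
      rw [← Complex.exp_add, ← Complex.exp_add, ← Complex.exp_add, ← Complex.exp_add]
      congr 2
      have hss : ((Real.sqrt s : ℝ) : ℂ) * ((Real.sqrt s : ℝ) : ℂ) = (s : ℂ) := by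
        rw [← Complex.ofReal_mul, Real.mul_self_sqrt hs.le]
      simp only [hα, Matrix.mulVec_smul, hYx, sympl_smul_smul, smul_dotProduct, dotProduct_smul,
        smul_eq_mul, ← hB, map_add, map_mul, map_neg, Complex.conj_ofReal, Complex.conj_I]
      push_cast
      have hħc : (ħ : ℂ) ≠ 0 := by exact_mod_cast hħ.ne'
      rw [← hss]
      field_simp
      ring
  have hz : z = toC (x 0) + I • toC (x 1) := by
    funext i
    simp only [hx, toC, Pi.add_apply, Pi.smul_apply, Matrix.cons_val_zero, Matrix.cons_val_one,
      smul_eq_mul]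
    rw [mul_comm, Complex.re_add_im]
  have hsz : star z = toC (x 0) - I • toC (x 1) := by
    rw [hz, star_add, star_smul, star_toC, star_toC, Complex.star_def, Complex.conj_I, neg_smul,
      sub_eq_add_neg]
  have hx2 : toC (x 2) = 0 := by
    funext i
    simp [hx, toC]
  have hsum : ∑ p, ∑ q, (starRingEnd ℂ) (c p) * c q * α p q
      = ((1 / ħ ^ 2 : ℝ) : ℂ) * (star z ⬝ᵥ (M *ᵥ z)) := by
    rw [hsz, hz]
    simp only [hα, Fin.sum_univ_three, hx2, Matrix.mulVec_zero, dotProduct_zero, zero_dotProduct,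
      Matrix.mulVec_add, Matrix.mulVec_smul, dotProduct_add, sub_dotProduct, smul_dotProduct,
      dotProduct_smul, smul_eq_mul, hc, Matrix.cons_val_zero, Matrix.cons_val_one,
      Matrix.cons_val, map_one, Complex.conj_I, map_neg, map_add]
    ring
  rw [hsum, Complex.re_ofReal_mul] at key
  have hre : 0 ≤ (star z ⬝ᵥ (M *ᵥ z)).re := by
    refine nonneg_of_mul_nonneg_right key (by positivity)
  refine Complex.le_def.2 ⟨hre, ?_⟩
  have := hherm.im_star_dotProduct_mulVec_self z
  simpa using this.symm

end CharacteristicFunction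

/-! ### The bound on the displacement orbit of the purification. -/

section SpanBound

variable {n : ℕ} {β : Type} {ħ : ℝ} {μ : (Unit ⊕ Fin n) × Fin 2 → ℝ}
  {S : Matrix ((Unit ⊕ Fin n) × Fin 2) ((Unit ⊕ Fin n) × Fin 2) ℝ}
  {ξ : lp (fun _ : β => ModeSpace (Unit ⊕ Fin n)) 2} {Z : Matrix (Fin 2) (Fin 2) ℂ}

/-- Parallel displacements of the first mode commute. This is why only Ωₙ, and not the full
symplectic form, enters the second constraint. -/
theorem sympl_joinModes_smul (v : Unit × Fin 2 → ℝ) (r t : ℝ) (u w : Fin n × Fin 2 → ℝ) :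
    sympl (joinModes (r • v) u) (joinModes (t • v) w) = sympl u w := by
  have h : sympl v v = 0 := Finset.sum_eq_zero fun j _ => by ring
  rw [sympl_joinModes, sympl_smul_smul, h, mul_zero, zero_add]

/-- The characteristic function, multiplied by `exp(z r²/(2ħ²))` along the direction `v`, is a
positive definite kernel. -/
theorem re_sum_inner_mul_exp_nonneg (hħ : 0 < ħ) (hS : S.IsSymm)
    (hξ : ∀ y, ⟪ξ, amplify β (displacement ħ y) ξ⟫_ℂ = gaussianChar ħ μ S y)
    (hZ : (S.map Complex.ofReal
        + (1 : ℂ) • lastBlock n ((I * ħ / 2) • (Omega (Fin n)).map Complex.ofReal)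
        - firstBlock n Z).PosSemidef)
    (v : Fin 2 → ℝ) {z : ℝ} (hz : toC (Omega1 *ᵥ v) ⬝ᵥ (Z *ᵥ toC (Omega1 *ᵥ v)) = (z : ℂ))
    {m : Type} [Fintype m] (r : m → ℝ) (u : m → Fin n × Fin 2 → ℝ) (c : m → ℂ) :
    0 ≤ (∑ p, ∑ q, (starRingEnd ℂ) (c p) * c q *
      (⟪amplify β (displacement ħ (joinModes (r p • fun b : Unit × Fin 2 => v b.2) (u p))) ξ,
        amplify β (displacement ħ (joinModes (r q • fun b : Unit × Fin 2 => v b.2) (u q))) ξ⟫_ℂ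
        * Real.exp (z * (r p - r q) ^ 2 / (2 * ħ ^ 2)))).re := by
  set y : m → (Unit ⊕ Fin n) × Fin 2 → ℝ :=
    fun p => joinModes (r p • fun b : Unit × Fin 2 => v b.2) (u p) with hy
  have hg := (hZ.gram fun p => toC (Omega (Unit ⊕ Fin n) *ᵥ y p)).smul
    (show (0 : ℝ) ≤ 1 / ħ ^ 2 by positivity)
  have h := hg.re_sum_exp_nonneg fun p => c p * (gaussianChar ħ μ S (y p)
    * Real.exp (z * r p ^ 2 / (2 * ħ ^ 2)))
  refine h.trans_eq (congrArg Complex.re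
    (Finset.sum_congr rfl fun p _ => Finset.sum_congr rfl fun q _ => Eq.symm ?_))
  rw [inner_amplify_displacement, hξ, exp_sympl_mul_gaussianChar hħ.ne' μ hS]
  simp only [Matrix.smul_apply, Matrix.of_apply, star_toC, map_mul, Complex.conj_ofReal]
  rw [hy, toC_dotProduct_constraint_mulVec, hz, sympl_joinModes_smul, Complex.real_smul]
  -- In (r_p - r_q)² = r_p² + r_q² - 2 r_p r_q the squares go into the coefficients, and the cross
  -- term is exactly the subtracted block Z ⊕ 0.
  have hexp : Complex.exp (((1 / ħ ^ 2 : ℝ) : ℂ) *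
      ((((Omega (Unit ⊕ Fin n) *ᵥ y p) ⬝ᵥ (S *ᵥ (Omega (Unit ⊕ Fin n) *ᵥ y q)) : ℝ) : ℂ)
        + I * ħ / 2 * sympl (u p) (u q))) * Real.exp (z * (r p - r q) ^ 2 / (2 * ħ ^ 2))
      = Real.exp (z * r p ^ 2 / (2 * ħ ^ 2)) * Real.exp (z * r q ^ 2 / (2 * ħ ^ 2)) *
        Complex.exp (((1 / ħ ^ 2 : ℝ) : ℂ) *
      ((((Omega (Unit ⊕ Fin n) *ᵥ y p) ⬝ᵥ (S *ᵥ (Omega (Unit ⊕ Fin n) *ᵥ y q)) : ℝ) : ℂ)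
        + I * ħ / 2 * sympl (u p) (u q) - r p * r q * z)) := by
    rw [Complex.ofReal_exp, Complex.ofReal_exp, Complex.ofReal_exp, ← Complex.exp_add,
      ← Complex.exp_add, ← Complex.exp_add]
    congr 1
    have hħc : (ħ : ℂ) ≠ 0 := by exact_mod_cast hħ.ne'
    push_cast
    field_simp
    ring
  simp only [hy] at hexp
  rw [mul_assoc _ (Complex.exp _), hexp]
  ring

theorem exists_norm_eq_mul (a : ℂ) : ∃ t : ℂ, (starRingEnd ℂ) t * t = 1 ∧ t * a = (‖a‖ : ℂ) := by
  by_cases ha : a = 0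
  · exact ⟨1, by simp, by simp [ha]⟩
  · have hn : (‖a‖ : ℂ) ≠ 0 := by simpa using ha
    refine ⟨(starRingEnd ℂ) a / ‖a‖, ?_, ?_⟩
    · rw [map_div₀, Complex.conj_conj, Complex.conj_ofReal, div_mul_div_comm, Complex.mul_conj,
        Complex.normSq_eq_norm_sq, div_eq_one_iff_eq (mul_ne_zero hn hn)]
      push_cast
      ring
    · rw [div_mul_eq_mul_div, div_eq_iff hn, mul_comm, Complex.mul_conj,
        Complex.normSq_eq_norm_sq]
      push_cast
      ring

/-- The bound on the closed span of the orbit of `ξ`. -/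
theorem norm_inner_amplify_displacement_le (hħ : 0 < ħ) (hS : S.IsSymm)
    (hξ : ∀ y, ⟪ξ, amplify β (displacement ħ y) ξ⟫_ℂ = gaussianChar ħ μ S y)
    (hZ : (S.map Complex.ofReal
        + (1 : ℂ) • lastBlock n ((I * ħ / 2) • (Omega (Fin n)).map Complex.ofReal)
        - firstBlock n Z).PosSemidef)
    (v : Fin 2 → ℝ) {z : ℝ} (hz : toC (Omega1 *ᵥ v) ⬝ᵥ (Z *ᵥ toC (Omega1 *ᵥ v)) = (z : ℂ))
    {η : lp (fun _ : β => ModeSpace (Unit ⊕ Fin n)) 2}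
    (hη : η ∈ (Submodule.span ℂ (Set.range fun u : Fin n × Fin 2 → ℝ =>
      amplify β (displacement ħ (joinModes 0 u)) ξ)).topologicalClosure) :
    ‖⟪η, amplify β (displacement ħ (joinModes (fun b : Unit × Fin 2 => v b.2) 0)) η⟫_ℂ‖
      ≤ Real.exp (-z / (2 * ħ ^ 2)) * ‖η‖ ^ 2 := by
  set V := amplify β (displacement ħ
    (joinModes (fun b : Unit × Fin 2 => v b.2) (0 : Fin n × Fin 2 → ℝ))) with hV
  have hcl : IsClosed {η : lp (fun _ : β => ModeSpace (Unit ⊕ Fin n)) 2 |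
      ‖⟪η, V η⟫_ℂ‖ ≤ Real.exp (-z / (2 * ħ ^ 2)) * ‖η‖ ^ 2} :=
    -- Both sides are continuous in η, so the bound need only be proved on finite linear
    -- combinations.
    isClosed_le (continuous_id.inner V.continuous).norm (by fun_prop)
  refine closure_minimal ?_ hcl hη
  intro η hη
  obtain ⟨m, c, g, rfl⟩ := Submodule.mem_span_set'.1 hη
  choose u hu using fun k => (g k).2
  simp only [← hu]
  set e : Fin m → lp (fun _ : β => ModeSpace (Unit ⊕ Fin n)) 2 :=
    fun k => amplify β (displacement ħ (joinModes 0 (u k))) ξ with he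
  have hVe : ∀ k, V (e k) = amplify β (displacement ħ
      (joinModes (fun b : Unit × Fin 2 => v b.2) (u k))) ξ := by
    intro k
    ext1; funext i
    simp only [he, hV, amplify_apply]
    rw [displacement_comp, joinModes_add, add_zero, zero_add, sympl_joinModes]
    have h1 : ∀ w : Unit × Fin 2 → ℝ, sympl w 0 = 0 := fun w => by simp [sympl]
    have h2 : ∀ w : Fin n × Fin 2 → ℝ, sympl 0 w = 0 := fun w => by simp [sympl]
    rw [h1, h2]
    simp
  have hee : ∀ k, amplify β (displacement ħ (joinModes 0 (u k))) ξ = e k := fun _ => rfl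
  have hVV : ∀ x y, ⟪V x, V y⟫_ℂ = ⟪x, y⟫_ℂ := by
    intro x y
    rw [lp.inner_eq_tsum, lp.inner_eq_tsum]
    exact tsum_congr fun i => inner_displacement_displacement _ _ _ _
  set η := ∑ k, c k • e k with hηdef
  change ‖⟪η, V η⟫_ℂ‖ ≤ Real.exp (-z / (2 * ħ ^ 2)) * ‖η‖ ^ 2
  -- The unimodular t aligns the phase of the cross terms. The test points combine η at r = 0 with
  -- -t V η at r = 1, so only the cross terms acquire the factor exp(z/(2ħ²)).
  obtain ⟨t, ht1, ht2⟩ := exists_norm_eq_mul ⟪η, V η⟫_ℂ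
  have hk := re_sum_inner_mul_exp_nonneg hħ hS hξ hZ v hz
    (Sum.elim (fun _ : Fin m => (0 : ℝ)) fun _ : Fin m => 1) (Sum.elim u u)
    (Sum.elim c fun k => -(t * c k))
  have hform : ∀ (x y : Fin m → lp (fun _ : β => ModeSpace (Unit ⊕ Fin n)) 2) (a b d : ℂ),
      ∑ p, ∑ q, (starRingEnd ℂ) (a * c p) * (b * c q) * (⟪x p, y q⟫_ℂ * d)
        = (starRingEnd ℂ) a * b * d * ⟪∑ p, c p • x p, ∑ q, c q • y q⟫_ℂ := by
    intro x y a b d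
    simp only [sum_inner, inner_sum, inner_smul_left, inner_smul_right, Finset.mul_sum, map_mul]
    rw [Finset.sum_comm]
    refine (Finset.sum_congr rfl fun p _ => Finset.sum_congr rfl fun q _ => by ring)
  have hVη : V η = ∑ k, c k • V (e k) := by
    rw [hηdef, map_sum]
    simp only [map_smul]
  have h00 := hform e e 1 1 1
  have h01 := hform e (fun k => V (e k)) 1 (-t) (Real.exp (z / (2 * ħ ^ 2)))
  have h10 := hform (fun k => V (e k)) e (-t) 1 (Real.exp (z / (2 * ħ ^ 2)))
  have h11 := hform (fun k => V (e k)) (fun k => V (e k)) (-t) (-t) 1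
  simp only [one_mul, mul_one, map_one, neg_mul] at h00 h01 h10 h11
  simp only [Fintype.sum_sum_type, Sum.elim_inl, Sum.elim_inr, zero_smul, one_smul, sub_self,
    zero_sub, sub_zero, Finset.sum_add_distrib, one_pow, neg_sq, mul_one, mul_zero, zero_div,
    ne_eq, OfNat.ofNat_ne_zero, not_false_eq_true, zero_pow,
    Real.exp_zero, Complex.ofReal_one, ← hVe, hee] at hk
  rw [h00, h10, h01, h11, ← hVη, ← hηdef, hVV, ← inner_conj_symm (V η) η, map_neg, neg_mul_neg,
    ht1, one_mul] at hk
  have hconj : (starRingEnd ℂ) t * (starRingEnd ℂ) ⟪η, V η⟫_ℂ = (‖⟪η, V η⟫_ℂ‖ : ℂ) := by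
    rw [← map_mul, ht2, Complex.conj_ofReal]
  have hfin : ⟪η, η⟫_ℂ + -(starRingEnd ℂ) t * (Real.exp (z / (2 * ħ ^ 2)) : ℂ)
      * (starRingEnd ℂ) ⟪η, V η⟫_ℂ
      + (-(t * (Real.exp (z / (2 * ħ ^ 2)) : ℂ) * ⟪η, V η⟫_ℂ) + ⟪η, η⟫_ℂ)
      = ((2 * (‖η‖ ^ 2 - Real.exp (z / (2 * ħ ^ 2)) * ‖⟪η, V η⟫_ℂ‖) : ℝ) : ℂ) := by
    have hn : ⟪η, η⟫_ℂ = ((‖η‖ ^ 2 : ℝ) : ℂ) := by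
      rw [inner_self_eq_norm_sq_to_K]
      norm_cast
    rw [hn]
    generalize Real.exp (z / (2 * ħ ^ 2)) = R
    push_cast
    linear_combination (-(R : ℂ)) * hconj - (R : ℂ) * ht2
  rw [hfin, Complex.ofReal_re] at hk
  rw [neg_div, Real.exp_neg, inv_mul_eq_div, le_div_iff₀ (Real.exp_pos _), mul_comm]
  linarith

end SpanBound

/-! ### The purification as a vector. -/

section HilbertSchmidtVector

variable {H : Type} [NormedAddCommGroup H] [InnerProductSpace ℂ H] [CompleteSpace H] {β : Type}

/-- A Hilbert–Schmidt operator as a vector of `ℓ²(β; H)`. -/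
def HilbertSchmidtOn.toLp {b : HilbertBasis β ℂ H} {A : H →L[ℂ] H} (hA : HilbertSchmidtOn b A) :
    lp (fun _ : β => H) 2 :=
  ⟨fun i => A (b i), memℓp_gen (by simpa [HilbertSchmidtOn] using hA)⟩

@[simp]
theorem HilbertSchmidtOn.toLp_apply {b : HilbertBasis β ℂ H} {A : H →L[ℂ] H}
    (hA : HilbertSchmidtOn b A) (i : β) : hA.toLp i = A (b i) := rfl

theorem inner_toLp_amplify_toLp {A D : H →L[ℂ] H} {b : HilbertBasis β ℂ H}
    (hA : ContinuousLinearMap.adjoint A = A) (hs : HilbertSchmidtOn b A) {t : ℂ}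
    (ht : HasTrace ((A ∘L A) ∘L D) t) : ⟪hs.toLp, amplify β D hs.toLp⟫_ℂ = t :=
  (lp.hasSum_inner _ _).unique (hasSum_inner_of_hasTrace hA hs ht)

end HilbertSchmidtVector

/-! ### Decomposition of the post-selected state into slices. -/

section Postselection

variable {ι κ : Type} [Fintype ι] [Fintype κ] {β γ δ : Type}

/-- `Tr (D Tr_κ (A² (1 ⊗ |h⟩⟨h|)))` for a Hilbert–Schmidt operator `A`. -/
def sliceTrace (A : ModeSpace (ι ⊕ κ) →L[ℂ] ModeSpace (ι ⊕ κ)) (f : HilbertBasis γ ℂ (ModeSpace ι))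
    (D : ModeSpace ι →L[ℂ] ModeSpace ι) (h : ModeSpace κ) : ℂ :=
  ∑' l, ⟪A (prodVec (f l) h), A (prodVec (D (f l)) h)⟫_ℂ

/-- Component i is T_h† A bᵢ ⊗ φ, with T_h the map f ↦ f ⊗ h. Cyclicity for the Hilbert–Schmidt
operator A T_h exchanges the sum over `b` for the sum over `f`, and φ contributes its squared norm.
-/
theorem inner_rankOneOrbit {A : ModeSpace (ι ⊕ κ) →L[ℂ] ModeSpace (ι ⊕ κ)}
    (hA : ContinuousLinearMap.adjoint A = A) {b : HilbertBasis β ℂ (ModeSpace (ι ⊕ κ))}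
    (hs : HilbertSchmidtOn b A) (f : HilbertBasis γ ℂ (ModeSpace ι)) (ħ : ℝ)
    (v : ι × Fin 2 → ℝ) (h : ModeSpace κ) :
    ⟪rankOneOrbit hs.toLp h, amplify β (displacement ħ (joinModes v 0)) (rankOneOrbit hs.toLp h)⟫_ℂ
      = ⟪gaussVec κ, gaussVec κ⟫_ℂ * sliceTrace A f (displacement ħ v) h := by
  have hY : HilbertSchmidtOn f (A ∘L tensorRight h) := hs.comp_right _ f
  have h1 := hY.hasSum_inner_adjoint (hY.comp_right (displacement ħ v) f) b
  have h2 := h1.mul_left ⟪gaussVec κ, gaussVec κ⟫_ℂ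
  have h3 := lp.hasSum_inner (𝕜 := ℂ) (rankOneOrbit hs.toLp h)
    (amplify β (displacement ħ (joinModes v 0)) (rankOneOrbit hs.toLp h))
  rw [← h3.tsum_eq]
  refine Eq.trans (tsum_congr fun i => ?_) h2.tsum_eq
  rw [rankOneOrbit_apply, amplify_apply, rankOneOrbit_apply, tensorRight_apply,
    displacement_prodVec, inner_prodVec, displacement_zero, mul_comm, HilbertSchmidtOn.toLp_apply,
    ContinuousLinearMap.adjoint_comp, ContinuousLinearMap.adjoint_comp, hA]
  simp only [ContinuousLinearMap.comp_apply]
  rw [ContinuousLinearMap.adjoint_inner_left (displacement ħ v)]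

/-- Cyclicity Tr (X†Y K²) = Tr (K X†Y K): in a basis of the target space both sides have the same
terms. It distributes E = K² symmetrically, which makes every slice a positive functional. -/
theorem hasSum_inner_comp_self {H H' : Type} [NormedAddCommGroup H] [InnerProductSpace ℂ H]
    [CompleteSpace H] [NormedAddCommGroup H'] [InnerProductSpace ℂ H'] [CompleteSpace H']
    {b : HilbertBasis β ℂ H} {X Y : H →L[ℂ] H'} (hX : HilbertSchmidtOn b X)
    (hY : HilbertSchmidtOn b Y) {K : H →L[ℂ] H} (hK : ContinuousLinearMap.adjoint K = K) :
    HasSum (fun j => ⟪X (K (b j)), Y (K (b j))⟫_ℂ) (∑' j, ⟪X (b j), Y (K (K (b j)))⟫_ℂ) := by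
  obtain ⟨w, e, -⟩ := exists_hilbertBasis ℂ H'
  have hXK := hX.comp_right K b
  have hYK := hY.comp_right K b
  have h1 := hX.hasSum_inner_adjoint (hYK.comp_right K b) e
  have h2 := hXK.hasSum_inner_adjoint hYK e
  have h3 : ∑' j, ⟪X (b j), ((Y ∘L K) ∘L K) (b j)⟫_ℂ = ∑' j, ⟪(X ∘L K) (b j), (Y ∘L K) (b j)⟫_ℂ := by
    rw [← h1.tsum_eq, ← h2.tsum_eq]
    refine tsum_congr fun j => ?_
    rw [ContinuousLinearMap.adjoint_comp (Y ∘L K), ContinuousLinearMap.adjoint_comp X, hK,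
      ContinuousLinearMap.comp_apply, ContinuousLinearMap.comp_apply]
    nth_rw 1 [← hK]
    rw [ContinuousLinearMap.adjoint_inner_left]
  have h4 := (hXK.summable_inner hYK).hasSum
  rw [← h3] at h4
  exact h4

/-- The matrix elements of a post-selected state as a sum over pure slices. -/
theorem IsPostselection.hasSum_inner {A : ModeSpace (ι ⊕ κ) →L[ℂ] ModeSpace (ι ⊕ κ)}
    (hA : ContinuousLinearMap.adjoint A = A) {b : HilbertBasis β ℂ (ModeSpace (ι ⊕ κ))}
    (hs : HilbertSchmidtOn b A) {K : ModeSpace κ →L[ℂ] ModeSpace κ}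
    (hK : ContinuousLinearMap.adjoint K = K) {p : ℝ} {τ : ModeSpace ι →L[ℂ] ModeSpace ι}
    (h : IsPostselection (A ∘L A) (K ∘L K) p τ) (d : HilbertBasis δ ℂ (ModeSpace κ))
    (x y : ModeSpace ι) :
    HasSum (fun j => ⟪A (prodVec x (K (d j))), A (prodVec y (K (d j)))⟫_ℂ) (p * ⟪x, τ y⟫_ℂ) := by
  have hX : ∀ x : ModeSpace ι, HilbertSchmidtOn d (A ∘L tensorLeft x) := fun x =>
    hs.comp_right _ d
  have h1 := hasSum_inner_comp_self (hX x) (hX y) hK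
  have h2 := (h.partialTrace x y δ d).tsum_eq
  rw [← h2]
  simp only [ContinuousLinearMap.comp_apply, inner_apply_comp_self hA]
  exact h1

/-- The trace of a post-selected state times an operator as a sum over pure slices. -/
theorem IsPostselection.hasSum_sliceTrace {A : ModeSpace (ι ⊕ κ) →L[ℂ] ModeSpace (ι ⊕ κ)}
    (hA : ContinuousLinearMap.adjoint A = A) {b : HilbertBasis β ℂ (ModeSpace (ι ⊕ κ))}
    (hs : HilbertSchmidtOn b A) {K : ModeSpace κ →L[ℂ] ModeSpace κ}
    (hK : ContinuousLinearMap.adjoint K = K) {p : ℝ} {τ : ModeSpace ι →L[ℂ] ModeSpace ι}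
    (h : IsPostselection (A ∘L A) (K ∘L K) p τ) (d : HilbertBasis δ ℂ (ModeSpace κ))
    (f : HilbertBasis γ ℂ (ModeSpace ι)) {D : ModeSpace ι →L[ℂ] ModeSpace ι} {t : ℂ}
    (ht : HasTrace (τ ∘L D) t) :
    HasSum (fun j => sliceTrace A f D (K (d j))) (p * t) := by
  obtain ⟨B, hB, rfl, hBs⟩ := h.density.exists_sqrt
  -- Summing over j first yields p ‖B C f_l‖², summable in l because B, the square root of τ, is
  -- Hilbert–Schmidt. This gives absolute convergence of the double sum.
  have hsq : ∀ C : ModeSpace ι →L[ℂ] ModeSpace ι,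
      Summable fun q : γ × δ => ‖A (prodVec (C (f q.1)) (K (d q.2)))‖ ^ 2 := by
    intro C
    have h1 : ∀ l, HasSum (fun j => ‖A (prodVec (C (f l)) (K (d j)))‖ ^ 2)
        (p * ‖B (C (f l))‖ ^ 2) := by
      intro l
      have h2 := Complex.hasSum_re (h.hasSum_inner hA hs hK d (C (f l)) (C (f l)))
      rw [ContinuousLinearMap.comp_apply, inner_apply_comp_self hB] at h2
      simpa only [inner_self_eq_ofReal, ← Complex.ofReal_mul, Complex.ofReal_re] using h2
    rw [summable_prod_of_nonneg fun _ => by positivity]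
    refine ⟨fun l => (h1 l).summable, ?_⟩
    simp only [(h1 _).tsum_eq]
    exact Summable.mul_left _ ((hBs _ f).comp_right C f)
  have hsum : Summable fun q : γ × δ =>
      ⟪A (prodVec (f q.1) (K (d q.2))), A (prodVec (D (f q.1)) (K (d q.2)))⟫_ℂ := by
    refine Summable.of_norm_bounded
      ((hsq (ContinuousLinearMap.id ℂ (ModeSpace ι))).add (hsq D)) fun q => ?_
    refine (norm_inner_le_norm _ _).trans ?_
    simp only [ContinuousLinearMap.id_apply]
    nlinarith [sq_nonneg (‖A (prodVec (f q.1) (K (d q.2)))‖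
        - ‖A (prodVec (D (f q.1)) (K (d q.2)))‖), sq_nonneg ‖A (prodVec (f q.1) (K (d q.2)))‖,
      sq_nonneg ‖A (prodVec (D (f q.1)) (K (d q.2)))‖]
  -- Summation over j first produces p Tr (τ D); the other order produces the slices.
  have h1 := hsum.hasSum.prod_fiberwise fun l => h.hasSum_inner hA hs hK d (f l) (D (f l))
  have h2 := h1.unique ((ht γ f).mul_left (p : ℂ))
  rw [← h2]
  have h3 := (Equiv.prodComm δ γ).hasSum_iff.2 hsum.hasSum
  refine h3.prod_fiberwise fun j => ?_
  exact (hsum.comp_injective (fun _ _ hl => (Prod.ext_iff.1 hl).1 :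
    Function.Injective fun l => (l, j))).hasSum

end Postselection

/-! ### From the expectation value to the squeezing parameter. -/

section Squeezing

theorem le_effectiveSqueezing {x : ℝ} {t : ℂ} (h : ‖t‖ ≤ Real.exp (-(Real.pi / 2) * x)) :
    (x : EReal) ≤ effectiveSqueezing t := by
  unfold effectiveSqueezing
  by_cases ht : t = 0
  · subst ht
    rw [enorm_zero, ENNReal.inv_zero, ENNReal.log_top, EReal.coe_mul_top_of_pos (by positivity)]
    exact le_top
  · have hn : 0 < ‖t‖ := norm_pos_iff.2 ht
    have h1 : (‖t‖ₑ)⁻¹ = ENNReal.ofReal (‖t‖⁻¹) := by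
      rw [← ofReal_norm, ENNReal.ofReal_inv_of_pos hn]
    rw [h1, ENNReal.log_ofReal_of_pos (inv_pos.2 hn), ← EReal.coe_mul, EReal.coe_le_coe_iff,
      Real.log_inv]
    have h2 := Real.log_le_log hn h
    rw [Real.log_exp] at h2
    have h3 : x = 2 / Real.pi * (Real.pi / 2 * x) := by
      field_simp
    rw [h3]
    exact mul_le_mul_of_nonneg_left (by linarith) (by positivity)

end Squeezing

end CVQuantum

end

open CVQuantum in
theorem mainTheorem7 (ħ : ℝ) (hħ : 0 < ħ) (n : ℕ)
    (ρ : CVQuantum.ModeSpace (Unit ⊕ Fin n) →L[ℂ] CVQuantum.ModeSpace (Unit ⊕ Fin n))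
    (μ : (Unit ⊕ Fin n) × Fin 2 → ℝ)
    (S : Matrix ((Unit ⊕ Fin n) × Fin 2) ((Unit ⊕ Fin n) × Fin 2) ℝ)
    (hρ : CVQuantum.IsGaussianState ħ ρ μ S) (v : Fin 2 → ℝ) :
    (∃ Z₀ ∈ CVQuantum.sdpFeasible ħ n (-1) S, ∀ Z ∈ CVQuantum.sdpFeasible ħ n (-1) S,
      CVQuantum.sdpObjective ħ v Z ≤ CVQuantum.sdpObjective ħ v Z₀) ∧
    ∀ s ∈ ({1, -1} : Set ℝ),
      ∀ (E : CVQuantum.ModeSpace (Fin n) →L[ℂ] CVQuantum.ModeSpace (Fin n)) (p : ℝ)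
        (τ : CVQuantum.ModeSpace Unit →L[ℂ] CVQuantum.ModeSpace Unit),
        CVQuantum.IsPostselection ρ E p τ →
          ∃ t : ℂ, CVQuantum.HasTrace (τ ∘L CVQuantum.displacement1 ħ v) t ∧
            (∀ Z ∈ CVQuantum.sdpFeasible ħ n s S,
              ‖t‖ ≤ Real.exp (-(Real.pi / 2) * CVQuantum.sdpObjective ħ v Z)) ∧
            CVQuantum.sdpValue ħ n s S v ≤ CVQuantum.effectiveSqueezing t := by
  obtain ⟨A, hA, rfl, hAs⟩ := hρ.density.exists_sqrt
  obtain ⟨w, b, -⟩ := exists_hilbertBasis ℂ (ModeSpace (Unit ⊕ Fin n))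
  have : Fact ((2 : ENNReal) ≠ ⊤) := ⟨by norm_num⟩
  have : Countable w := b.countable_index
  have hs := hAs _ b
  have hξ : ∀ y, inner ℂ hs.toLp (amplify w (displacement ħ y) hs.toLp) = gaussianChar ħ μ S y :=
    fun y => inner_toLp_amplify_toLp hA hs (hρ.charFun y)
  refine ⟨exists_isMax_sdpObjective hρ.symm (uncertainty_relation hħ hρ.symm hξ) v, ?_⟩
  intro s hsign E p τ h
  obtain ⟨t, ht⟩ := h.density.exists_hasTrace_comp (displacement1 ħ v)
  have hbound : ∀ Z ∈ sdpFeasible ħ n s S,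
      ‖t‖ ≤ Real.exp (-(Real.pi / 2) * sdpObjective ħ v Z) := by
    intro Z hZ
    -- From here only the sign +1 occurs, with Z' in place of Z; the number z is the same for both.
    obtain ⟨Z', hZ'eq, hZ'⟩ := exists_posSemidef_of_mem_sdpFeasible hρ.symm hsign hZ (Omega1.mulVec v)
    set z : ℝ := (toC (Omega1.mulVec v) ⬝ᵥ (Z.mulVec (toC (Omega1.mulVec v)))).re with hz
    have hzC : toC (Omega1.mulVec v) ⬝ᵥ (Z'.mulVec (toC (Omega1.mulVec v))) = (z : ℂ) := by
      rw [hZ'eq]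
      exact Complex.ext rfl (im_toC_dotProduct_mulVec hZ.1 _)
    have hexp : -(Real.pi / 2) * sdpObjective ħ v Z = -z / (2 * ħ ^ 2) := by
      rw [sdpObjective_eq, ← hz]
      have := Real.pi_ne_zero
      field_simp
    rw [hexp]
    obtain ⟨K, hK, rfl⟩ := h.effect.1.exists_sqrt
    obtain ⟨wd, d, -⟩ := exists_hilbertBasis ℂ (ModeSpace (Fin n))
    obtain ⟨wf, f, -⟩ := exists_hilbertBasis ℂ (ModeSpace Unit)
    have hφ : 0 < ‖gaussVec (Fin n)‖ ^ 2 := by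
      have := norm_pos_iff.2 (gaussVec_ne_zero (κ := Fin n))
      positivity
    -- The orbit bound applied to (1 ⊗ |φ⟩⟨g|) ξ; both sides carry the factor ‖φ‖², which cancels.
    have hslice : ∀ g : ModeSpace (Fin n), ‖sliceTrace A f (displacement1 ħ v) g‖
        ≤ Real.exp (-z / (2 * ħ ^ 2)) * (sliceTrace A f (displacement ħ 0) g).re := by
      intro g
      have h1 := norm_inner_amplify_displacement_le hħ hρ.symm hξ hZ' v hzC
        (rankOneOrbit_mem_closure hħ hs.toLp g)
      rw [inner_rankOneOrbit hA hs f, norm_mul, inner_self_eq_ofReal, Complex.norm_real,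
        Real.norm_of_nonneg (sq_nonneg _)] at h1
      -- The zero displacement expresses the squared norm of the same vector as a slice trace.
      have h2 := inner_rankOneOrbit hA hs f ħ 0 g
      have h3 : amplify w (displacement ħ (joinModes (0 : Unit × Fin 2 → ℝ) 0))
          (rankOneOrbit hs.toLp g) = rankOneOrbit hs.toLp g := by
        ext1; funext i
        rw [amplify_apply]
        have : joinModes (0 : Unit × Fin 2 → ℝ) (0 : Fin n × Fin 2 → ℝ) = 0 := by
          funext ⟨a, i⟩
          cases a <;> rfl
        rw [this, displacement_zero]
      rw [h3, inner_self_eq_ofReal, inner_self_eq_ofReal] at h2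
      have h4 : ‖rankOneOrbit hs.toLp g‖ ^ 2
          = ‖gaussVec (Fin n)‖ ^ 2 * (sliceTrace A f (displacement ħ 0) g).re := by
        have h5 := congrArg Complex.re h2
        rwa [Complex.re_ofReal_mul, Complex.ofReal_re] at h5
      rw [h4] at h1
      have h6 : ‖gaussVec (Fin n)‖ ^ 2 * ‖sliceTrace A f (displacement1 ħ v) g‖
          ≤ ‖gaussVec (Fin n)‖ ^ 2 * (Real.exp (-z / (2 * ħ ^ 2))
            * (sliceTrace A f (displacement ħ 0) g).re) := by
        rw [mul_left_comm]
        exact h1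
      exact le_of_mul_le_mul_left h6 hφ
    have hsum1 := h.hasSum_sliceTrace hA hs hK d f ht
    have hone : HasTrace (τ ∘L displacement ħ 0) 1 := by
      have : displacement ħ (0 : Unit × Fin 2 → ℝ) = ContinuousLinearMap.id ℂ _ :=
        ContinuousLinearMap.ext fun ψ => displacement_zero ħ ψ
      rw [this, ContinuousLinearMap.comp_id]
      exact h.density.2
    have hsum2 := (Complex.hasSum_re (h.hasSum_sliceTrace hA hs hK d f hone)).mul_left
      (Real.exp (-z / (2 * ħ ^ 2)))
    -- Summing the slice bounds over g = K dⱼ gives p |t| on the left and exp(-z/(2ħ²)) p on the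
    -- right, since τ has trace one.
    have h1 := tsum_of_norm_bounded hsum2 fun j => hslice (K (d j))
    rw [hsum1.tsum_eq, norm_mul, mul_one, Complex.ofReal_re, Complex.norm_real,
      Real.norm_of_nonneg h.prob_pos.le, mul_comm] at h1
    exact le_of_mul_le_mul_right h1 h.prob_pos
  exact ⟨t, ht, hbound, iSup₂_le fun Z hZ => le_effectiveSqueezing (hbound Z hZ)⟩
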